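/- Let $K$ be a field of characteristic different from $2$ and let $X$ be a connected poset (any two elements are joined by a finite sequence whose consecutive terms are comparable). Let $FI(X,K)$ be the finitary incidence algebra: the functions $f:X\times X\to K$ with $f(x,y)=0$ if $x\nleq y$ and such that for all $x\le y$ only finitely many subintervals $[u,v]\subseteq[x,y]$ with $u\ne v$ satisfy $f(u,v)\neq 0$, with the convolution product $(fg)(x,y)=\sum_{x\le z\le y}f(x,z)g(z,y)$. Assume that every multiplicative automorphism of $FI(X,K)$ is inner, that is, every automorphism $f\mapsto\big((x,y)\mapsto\sigma(x,y)f(x,y)\big)$, where $\sigma(x,y)\ne0$ for $x\le y$, $\sigma(x,y)=0$ for $x\nleq y$, and $\sigma(x,y)\sigma(y,z)=\sigma(x,z)$ for $x\le y\le z$, has the form $\Psi_w: f\mapsto wfw^{-1}$ with $w$ invertible. An involution of a ring $A$ is an additive map $\rho:A\to A$ with $\rho(ab)=\rho(b)\rho(a)$ and $\rho^2=\mathrm{id}$; it is of the second kind if it is not the identity on the center of $A$. Let $\ast$ be an involution of the second kind on $K$, and put $K_0=\{a\in K: a^\ast=a\}$ and $K_1=\{aa^\ast: a\in K^\times\}$,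 a subgroup of $K_0^\times$. Let $\lambda$ be an involution of $X$ ($\lambda^2=\mathrm{id}$, and $x\le y\Leftrightarrow\lambda(y)\le\lambda(x)$) whose fixed set $X_3=\{x\in X:\lambda(x)=x\}$ is nonempty. An involution $\rho$ of $FI(X,K)$ induces $\lambda$ on $X$ and $\ast$ on $K$ if $\rho(e_x)$ is conjugate, by an invertible element, to $e_{\lambda(x)}$ for every $x\in X$, where $e_x$ is the idempotent that is $1$ at $(x,x)$ and $0$ elsewhere, and $\rho|_K=\ast$. Two involutions $\rho_1,\rho_2$ of $FI(X,K)$ are equivalent via inner automorphisms if $\Psi_w\circ\rho_1=\rho_2\circ\Psi_w$ for some invertible $w$. Call $\theta_1,\theta_2\in(K_0^\times/K_1)^{X_3}$ equivalent if there is $g\in K_0^\times/K_1$ with $\theta_1(x)=g\,\theta_2(x)$ for all $x\in X_3$. For $\epsilon:X_3\to K_0^\times$ let $\theta_\epsilon$ be its composition with the projection $K_0^\times\to K_0^\times/K_1$, let $u_\epsilon$ be the diagonal element of $FI(X,K)$ with $u_\epsilon(x,x)=\epsilon(x)$ for $x\in X_3$ and $u_\epsilon(x,x)=1$ for $x\notin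 X_3$, and let $\rho_\epsilon$ be the involution $\rho_\epsilon(f)=u_\epsilon\,\rho_\lambda^\ast(f)\,u_\epsilon^{-1}$, where $\rho_\lambda^\ast(f)(x,y)=f(\lambda(y),\lambda(x))^\ast$. Say that an involution $\rho$ induces the class of $\theta_\epsilon$ if $\rho$ is equivalent to $\rho_\epsilon$ via inner automorphisms. Then: (i) every involution of $FI(X,K)$ that induces $\lambda$ on $X$ and $\ast$ on $K$ induces exactly one equivalence class of $(K_0^\times/K_1)^{X_3}$; (ii) two involutions $\rho_1,\rho_2$ of $FI(X,K)$ that induce $\lambda$ on $X$ and $\ast$ on $K$ are equivalent via inner automorphisms if and only if they induce the same equivalence class of $(K_0^\times/K_1)^{X_3}$; (iii) the set of classes, under equivalence via inner automorphisms, of the involutions of $FI(X,K)$ that induce $\lambda$ on $X$ and $\ast$ on $K$ has cardinality $|K_0^\times/K_1|^{|X_3|-1}$, where $|X_3|-1$ denotes the cardinality of $X_3$ with one point removed. -/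

import Mathlib

open scoped Cardinal

universe u v

namespace FinInc

/-! ### Involutions of rings -/

section Involutions

variable {A : Type*} [Ring A]

/-- An involution of the second kind: it is not the identity on the centre. -/
def IsSecondKind (ρ : RingInvo A) : Prop :=
  ∃ a ∈ Set.center A, (ρ a).unop ≠ a

/-- Equivalence via inner automorphisms: `Ψ_w ∘ ρ₁ = ρ₂ ∘ Ψ_w` for some invertible `w`,
where `Ψ_w a = w * a * w⁻¹`. -/
def InnerEquiv (ρ₁ ρ₂ : RingInvo A) : Prop :=
  ∃ w : Aˣ, ∀ a : A, ↑w * (ρ₁ a).unop * ↑w⁻¹ = (ρ₂ (↑w * a * ↑w⁻¹)).unop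

theorem unop_map_mul (ρ : RingInvo A) (a b : A) :
    (ρ (a * b)).unop = (ρ b).unop * (ρ a).unop := by
  rw [map_mul, MulOpposite.unop_mul]

theorem innerEquiv_refl (ρ : RingInvo A) : InnerEquiv ρ ρ :=
  ⟨1, fun a => by simp⟩

theorem innerEquiv_symm {ρ₁ ρ₂ : RingInvo A} (h : InnerEquiv ρ₁ ρ₂) : InnerEquiv ρ₂ ρ₁ := by
  obtain ⟨w, hw⟩ := h
  refine ⟨w⁻¹, fun a => ?_⟩
  have h1 : (↑w : A) * (↑w⁻¹ * a * ↑w) * ↑w⁻¹ = a := by simp [mul_assoc]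
  have h2 := hw (↑w⁻¹ * a * ↑w)
  rw [h1] at h2
  rw [inv_inv, ← h2]
  simp only [mul_assoc, Units.inv_mul, mul_one, Units.inv_mul_cancel_left]

theorem innerEquiv_trans {ρ₁ ρ₂ ρ₃ : RingInvo A} (h : InnerEquiv ρ₁ ρ₂)
    (h' : InnerEquiv ρ₂ ρ₃) : InnerEquiv ρ₁ ρ₃ := by
  obtain ⟨w, hw⟩ := h
  obtain ⟨w', hw'⟩ := h'
  refine ⟨w' * w, fun a => ?_⟩
  have h1 := hw' (↑w * a * ↑w⁻¹)
  rw [← hw] at h1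
  simpa [mul_assoc] using h1

/-- For a `ρ`-symmetric invertible `w`, the involution `Ψ_w ∘ ρ`. -/
def conjInvo (ρ : RingInvo A) (w : Aˣ) (hw : (ρ (w : A)).unop = w) : RingInvo A :=
  have hw' : (ρ (↑w⁻¹ : A)).unop = ↑w⁻¹ := by
    have h1 : (ρ (↑w⁻¹ : A)).unop * w = 1 := by
      conv_lhs => rw [← hw]
      rw [← unop_map_mul, Units.mul_inv]; simp
    exact (Units.inv_eq_of_mul_eq_one_left h1).symm
  RingInvo.mk'
    { toFun := fun a => MulOpposite.op (↑w * (ρ a).unop * ↑w⁻¹)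
      map_one' := by simp
      map_zero' := by simp
      map_add' := fun a b => by simp [mul_add, add_mul]
      map_mul' := fun a b => by
        rw [← MulOpposite.op_mul, unop_map_mul]
        simp [mul_assoc] }
    (fun a => by
      simp only [RingHom.coe_mk, MonoidHom.coe_mk, OneHom.coe_mk, MulOpposite.unop_op,
        unop_map_mul, RingInvo.involution, hw, hw']
      simp [mul_assoc])

end Involutions

/-! ### The fixed field of an involution of a field and its subgroup of norms -/

section Field

variable {K : Type*} [Field K]

/-- `K₀ = {a ∈ K : a* = a}`. -/
def fixedField (s : RingInvo K) : Subfield K where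
  carrier := {a | (s a).unop = a}
  mul_mem' {a b} ha hb := by
    simp only [Set.mem_ofPred_eq] at *
    rw [unop_map_mul, ha, hb, mul_comm]
  one_mem' := by simp
  add_mem' {a b} ha hb := by
    simp only [Set.mem_ofPred_eq] at *
    simp [ha, hb]
  zero_mem' := by simp
  neg_mem' {a} ha := by
    simp only [Set.mem_ofPred_eq] at *
    have : s (-a) = -s a := map_neg (s : K ≃+* Kᵐᵒᵖ) a
    rw [this, MulOpposite.unop_neg, ha]
  inv_mem' a ha := by
    simp only [Set.mem_ofPred_eq] at *
    have : s a⁻¹ = (s a)⁻¹ := map_inv₀ (s : K ≃+* Kᵐᵒᵖ) a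
    rw [this, MulOpposite.unop_inv, ha]

/-- `K₁ = {a a* : a ∈ K, a ≠ 0}`, as a subgroup of `K₀ˣ`. -/
def normSubgroup (s : RingInvo K) : Subgroup (fixedField s)ˣ where
  carrier := {c | ∃ a : K, a ≠ 0 ∧ ((c : fixedField s) : K) = a * (s a).unop}
  mul_mem' {c d} hc hd := by
    obtain ⟨a, ha, hc⟩ := hc
    obtain ⟨b, hb, hd⟩ := hd
    refine ⟨a * b, mul_ne_zero ha hb, ?_⟩
    rw [unop_map_mul, Units.val_mul, Subfield.coe_mul, hc, hd]
    ring
  one_mem' := ⟨1, one_ne_zero, by simp⟩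
  inv_mem' {c} hc := by
    obtain ⟨a, ha, hc⟩ := hc
    refine ⟨a⁻¹, inv_ne_zero ha, ?_⟩
    have : s a⁻¹ = (s a)⁻¹ := map_inv₀ (s : K ≃+* Kᵐᵒᵖ) a
    rw [this, MulOpposite.unop_inv, Units.val_inv_eq_inv_val, Subfield.coe_inv, hc, mul_inv]

/-- The group `K₀ˣ / K₁`. -/
abbrev NormQuotient (s : RingInvo K) : Type _ :=
  (fixedField s)ˣ ⧸ normSubgroup s

end Field

/-! ### Posets -/

section Poset

variable {X : Type u} [PartialOrder X]

/-- Any two elements are joined by a finite sequence whose consecutive members are comparable. -/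
def ConnectedPoset (X : Type u) [PartialOrder X] : Prop :=
  ∀ x y : X, Relation.ReflTransGen (fun a b : X => a ≤ b ∨ b ≤ a) x y

/-- An involution of the poset `X`. -/
structure IsPosetInvolution (lam : X → X) : Prop where
  invol : ∀ x, lam (lam x) = x
  le_iff : ∀ x y, x ≤ y ↔ lam y ≤ lam x

/-- `X₃`, the set of fixed points of `lam`. -/
abbrev FixedSet (lam : X → X) : Type u := {x : X // lam x = x}

end Poset

/-! ### The finitary incidence algebra -/

/-- `FI(X,K)` as a subspace of the space of all functions `X × X → K` (in curried form):
`f x y = 0` unless `x ≤ y`, and for `x ≤ y` only finitely many proper subintervals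
`[p.1, p.2]` of `[x, y]` satisfy `f p.1 p.2 ≠ 0`. -/
def finitarySubspace (X : Type u) (K : Type v) [PartialOrder X] [Field K] :
    Submodule K (X → X → K) where
  carrier := {f | (∀ x y, ¬ x ≤ y → f x y = 0) ∧ ∀ x y, x ≤ y →
    {p : X × X | x ≤ p.1 ∧ p.1 ≤ p.2 ∧ p.2 ≤ y ∧ p.1 ≠ p.2 ∧ f p.1 p.2 ≠ 0}.Finite}
  add_mem' {f g} hf hg := by
    refine ⟨fun x y h => by simp [hf.1 x y h, hg.1 x y h], fun x y h => ?_⟩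
    refine ((hf.2 x y h).union (hg.2 x y h)).subset ?_
    rintro p ⟨h1, h2, h3, h4, h5⟩
    by_cases h6 : f p.1 p.2 = 0
    · exact Or.inr ⟨h1, h2, h3, h4, by simpa [h6] using h5⟩
    · exact Or.inl ⟨h1, h2, h3, h4, h6⟩
  zero_mem' := ⟨fun _ _ _ => rfl, fun x y _ => by simp⟩
  smul_mem' c f hf := by
    refine ⟨fun x y h => by simp [hf.1 x y h], fun x y h => ?_⟩
    refine (hf.2 x y h).subset ?_
    rintro p ⟨h1, h2, h3, h4, h5⟩
    exact ⟨h1, h2, h3, h4, fun h6 => h5 (by simp [h6])⟩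

/-- The finitary incidence algebra `FI(X,K)`. -/
abbrev FI (X : Type u) (K : Type v) [PartialOrder X] [Field K] : Type (max u v) :=
  finitarySubspace X K

section FI

variable {X : Type u} {K : Type v} [PartialOrder X] [Field K]

instance : CoeFun (FI X K) (fun _ => X → X → K) := ⟨fun f => f.1⟩

@[ext] theorem FI.ext {f g : FI X K} (h : ∀ x y, f x y = g x y) : f = g :=
  Subtype.ext (funext fun x => funext fun y => h x y)

theorem FI.apply_of_not_le (f : FI X K) {x y : X} (h : ¬ x ≤ y) : f x y = 0 := f.2.1 x y h

theorem FI.le_of_ne (f : FI X K) {x y : X} (h : f x y ≠ 0) : x ≤ y := by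
  by_contra h'
  exact h (f.2.1 x y h')

@[simp] theorem FI.add_apply (f g : FI X K) (x y : X) : (f + g) x y = f x y + g x y := rfl
@[simp] theorem FI.zero_apply (x y : X) : (0 : FI X K) x y = 0 := rfl
@[simp] theorem FI.smul_apply (c : K) (f : FI X K) (x y : X) : (c • f) x y = c * f x y := rfl

theorem FI.exists_finset (f : FI X K) (x y : X) :
    ∃ S : Finset X, ∀ u v, x ≤ u → v ≤ y → f u v ≠ 0 → u ≠ v → u ∈ S ∧ v ∈ S := by
  classical
  by_cases h : x ≤ y
  · have hfin := f.2.2 x y h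
    refine ⟨hfin.toFinset.image Prod.fst ∪ hfin.toFinset.image Prod.snd,
      fun u v hu hv hne huv => ?_⟩
    have hm : (u, v) ∈ hfin.toFinset := by
      rw [Set.Finite.mem_toFinset]
      exact ⟨hu, f.le_of_ne hne, hv, huv, hne⟩
    exact ⟨Finset.mem_union_left _ (Finset.mem_image_of_mem Prod.fst hm),
      Finset.mem_union_right _ (Finset.mem_image_of_mem Prod.snd hm)⟩
  · exact ⟨∅, fun u v hu hv hne _ => absurd (hu.trans ((f.le_of_ne hne).trans hv)) h⟩

/-- The convolution product `(fg)(x,y) = ∑_{x ≤ z ≤ y} f(x,z) g(z,y)`; only finitely many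
terms are nonzero. -/
noncomputable def conv (f g : FI X K) (x y : X) : K :=
  ∑ᶠ z ∈ Set.Icc x y, f x z * g z y

theorem conv_eq_sum (f g : FI X K) {x y : X} (S : Finset X)
    (hS : ∀ z, z ≤ y → f x z ≠ 0 → z ∈ S) :
    conv f g x y = ∑ z ∈ S, f x z * g z y := by
  have key : ∀ z, (∑ᶠ (_ : z ∈ Set.Icc x y), f x z * g z y) = f x z * g z y := by
    intro z
    by_cases hz : z ∈ Set.Icc x y
    · simp [hz]
    · have h0 : (∑ᶠ (_ : z ∈ Set.Icc x y), f x z * g z y) = 0 := by simp [hz]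
      rw [h0]
      by_cases h1 : x ≤ z
      · rw [g.apply_of_not_le (fun h2 => hz ⟨h1, h2⟩), mul_zero]
      · rw [f.apply_of_not_le h1, zero_mul]
  unfold conv
  rw [finsum_congr key]
  refine finsum_eq_sum_of_support_subset _ fun z hz => ?_
  have h1 : f x z ≠ 0 := left_ne_zero_of_mul hz
  have h2 : g z y ≠ 0 := right_ne_zero_of_mul hz
  exact Finset.mem_coe.2 (hS z (g.le_of_ne h2) h1)

theorem exists_of_conv_ne (f g : FI X K) {x y : X} (h : conv f g x y ≠ 0) :
    ∃ z, f x z ≠ 0 ∧ g z y ≠ 0 := by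
  by_contra! h'
  refine h (finsum_mem_eq_zero_of_forall_eq_zero fun z _ => ?_)
  by_cases hz : f x z = 0
  · rw [hz, zero_mul]
  · rw [h' z hz, mul_zero]

theorem conv_mem (f g : FI X K) : conv f g ∈ finitarySubspace X K := by
  refine ⟨fun x y h => ?_, fun x y h => ?_⟩
  · by_contra h'
    obtain ⟨z, h1, h2⟩ := exists_of_conv_ne f g h'
    exact h ((f.le_of_ne h1).trans (g.le_of_ne h2))
  · obtain ⟨S, hS⟩ := f.exists_finset x y
    obtain ⟨T, hT⟩ := g.exists_finset x y
    classical
    refine ((S ∪ T) ×ˢ (S ∪ T)).finite_toSet.subset ?_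
    rintro ⟨p, q⟩ ⟨h1, h2, h3, h4, h5⟩
    obtain ⟨z, hz1, hz2⟩ := exists_of_conv_ne f g h5
    dsimp only at *
    have hzp := f.le_of_ne hz1
    have hzq := g.le_of_ne hz2
    have := hS p z h1 (hzq.trans h3) hz1
    have := hT z q (h1.trans hzp) h3 hz2
    simp only [Finset.coe_product, Set.mem_prod, Finset.mem_coe, Finset.mem_union]
    by_cases e1 : p = z
    · subst e1; tauto
    · by_cases e2 : z = q
      · subst e2; tauto
      · tauto

noncomputable instance : Mul (FI X K) := ⟨fun f g => ⟨conv f g, conv_mem f g⟩⟩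

theorem FI.mul_apply (f g : FI X K) (x y : X) :
    (f * g) x y = ∑ᶠ z ∈ Set.Icc x y, f x z * g z y := rfl

theorem FI.mul_apply_sum (f g : FI X K) {x y : X} (S : Finset X)
    (hS : ∀ z, z ≤ y → f x z ≠ 0 → z ∈ S) :
    (f * g) x y = ∑ z ∈ S, f x z * g z y := conv_eq_sum f g S hS

theorem FI.exists_finset' (f : FI X K) (x y : X) :
    ∃ S : Finset X, ∀ z, z ≤ y → f x z ≠ 0 → z ∈ S := by
  classical
  obtain ⟨S, hS⟩ := f.exists_finset x y
  refine ⟨insert x S, fun z hz hne => ?_⟩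
  by_cases h : x = z
  · simp [h]
  · exact Finset.mem_insert_of_mem (hS x z le_rfl hz hne h).2

open Classical in
/-- The diagonal element with entries `d x`. -/
noncomputable def diag (d : X → K) : FI X K :=
  ⟨fun x y => if x = y then d x else 0,
    fun x y h => if_neg fun e => h e.le,
    fun x y _ => by
      convert Set.finite_empty
      ext p
      simp only [Set.mem_ofPred_eq, Set.mem_empty_iff_false, iff_false]
      rintro ⟨-, -, -, h4, h5⟩
      exact h5 (if_neg h4)⟩

open Classical in
theorem diag_apply (d : X → K) (x y : X) : diag d x y = if x = y then d x else 0 := rfl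

theorem diag_mul_apply (d : X → K) (f : FI X K) (x y : X) :
    (diag d * f) x y = d x * f x y := by
  rw [FI.mul_apply_sum (S := {x})]
  · simp [diag_apply]
  · intro z _ hz
    by_contra h
    exact hz (if_neg fun e => h (by simp [e]))

theorem mul_diag_apply (d : X → K) (f : FI X K) (x y : X) :
    (f * diag d) x y = f x y * d y := by
  obtain ⟨S, hS⟩ := f.exists_finset' x y
  rw [FI.mul_apply_sum f _ S hS, Finset.sum_eq_single y]
  · simp [diag_apply]
  · intro z _ hz
    simp [diag_apply, hz]
  · intro hy
    by_cases h : f x y = 0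
    · rw [h, zero_mul]
    · exact absurd (hS y le_rfl h) hy

/-- The unity `δ`. -/
noncomputable instance : One (FI X K) := ⟨diag fun _ => 1⟩

theorem FI.one_def : (1 : FI X K) = diag fun _ => 1 := rfl

theorem FI.mul_assoc' (f g h : FI X K) : f * g * h = f * (g * h) := by
  classical
  ext x y
  obtain ⟨S₁, h₁⟩ := f.exists_finset' x y
  obtain ⟨S₂, h₂⟩ := (f * g).exists_finset' x y
  obtain ⟨S₃, h₃⟩ := g.exists_finset x y
  set S := S₁ ∪ S₂ ∪ S₃ with hS
  have m₁ : ∀ z, z ≤ y → f x z ≠ 0 → z ∈ S := fun z hz hne => by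
    simp [hS, h₁ z hz hne]
  have m₂ : ∀ z, z ≤ y → (f * g) x z ≠ 0 → z ∈ S := fun z hz hne => by
    simp [hS, h₂ z hz hne]
  have m₃ : ∀ w ∈ S, x ≤ w → ∀ z, z ≤ y → g w z ≠ 0 → z ∈ S := fun w hw hxw z hz hne => by
    by_cases e : w = z
    · exact e ▸ hw
    · simp [hS, (h₃ w z hxw hz hne e).2]
  rw [FI.mul_apply_sum (f * g) h S m₂, FI.mul_apply_sum f (g * h) S m₁]
  have e1 : ∀ z ∈ S, (f * g) x z * h z y = ∑ w ∈ S, f x w * g w z * h z y := by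
    intro z _
    by_cases hzy : z ≤ y
    · rw [FI.mul_apply_sum f g S fun w hw hne => m₁ w (hw.trans hzy) hne, Finset.sum_mul]
    · simp [h.apply_of_not_le hzy]
  have e2 : ∀ w ∈ S, f x w * (g * h) w y = ∑ z ∈ S, f x w * g w z * h z y := by
    intro w hw
    by_cases hxw : x ≤ w
    · rw [FI.mul_apply_sum g h S (m₃ w hw hxw), Finset.mul_sum]
      simp [mul_assoc]
    · simp [f.apply_of_not_le hxw]
  rw [Finset.sum_congr rfl e1, Finset.sum_congr rfl e2, Finset.sum_comm]

theorem FI.mul_add' (f g h : FI X K) : f * (g + h) = f * g + f * h := by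
  ext x y
  obtain ⟨S, hS⟩ := f.exists_finset' x y
  rw [FI.add_apply, FI.mul_apply_sum f _ S hS, FI.mul_apply_sum f _ S hS,
    FI.mul_apply_sum f _ S hS, ← Finset.sum_add_distrib]
  simp [mul_add]

theorem FI.add_mul' (f g h : FI X K) : (f + g) * h = f * h + g * h := by
  classical
  ext x y
  obtain ⟨S, hS⟩ := f.exists_finset' x y
  obtain ⟨T, hT⟩ := g.exists_finset' x y
  obtain ⟨U, hU⟩ := (f + g).exists_finset' x y
  rw [FI.add_apply,
    FI.mul_apply_sum f _ (S ∪ T ∪ U) fun z hz hne => by simp [hS z hz hne],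
    FI.mul_apply_sum g _ (S ∪ T ∪ U) fun z hz hne => by simp [hT z hz hne],
    FI.mul_apply_sum (f + g) _ (S ∪ T ∪ U) fun z hz hne => by simp [hU z hz hne],
    ← Finset.sum_add_distrib]
  simp [add_mul]

noncomputable instance : Ring (FI X K) :=
  { (inferInstance : AddCommGroup (FI X K)) with
    mul := (· * ·)
    one := 1
    mul_assoc := FI.mul_assoc'
    one_mul := fun f => by ext x y; rw [FI.one_def, diag_mul_apply, one_mul]
    mul_one := fun f => by ext x y; rw [FI.one_def, mul_diag_apply, mul_one]
    left_distrib := FI.mul_add'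
    right_distrib := FI.add_mul'
    zero_mul := fun f => by
      have h := FI.add_mul' 0 0 f
      rw [add_zero] at h
      exact left_eq_add.1 h
    mul_zero := fun f => by
      have h := FI.mul_add' f 0 0
      rw [add_zero] at h
      exact left_eq_add.1 h }

theorem smul_eq_diag_mul (c : K) (f : FI X K) : c • f = diag (fun _ => c) * f := by
  ext x y
  rw [FI.smul_apply, diag_mul_apply]

noncomputable instance : Algebra K (FI X K) :=
  Algebra.ofModule
    (fun c f g => by rw [smul_eq_diag_mul, smul_eq_diag_mul, mul_assoc])
    (fun c f g => by
      have hc : f * diag (fun _ => c) = diag (fun _ => c) * f := by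
        ext x y
        rw [diag_mul_apply, mul_diag_apply, mul_comm]
      rw [smul_eq_diag_mul, smul_eq_diag_mul, ← mul_assoc, hc, mul_assoc])

open Classical in
/-- The idempotent `e_x`. -/
noncomputable def idem (K : Type v) [Field K] (x : X) : FI X K :=
  diag fun z => if z = x then 1 else 0

/-- A diagonal element with nonzero diagonal entries, as a unit. -/
noncomputable def diagUnit (d : X → K) (hd : ∀ x, d x ≠ 0) : (FI X K)ˣ where
  val := diag d
  inv := diag fun x => (d x)⁻¹
  val_inv := by
    ext x y
    rw [diag_mul_apply, FI.one_def, diag_apply, diag_apply]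
    split_ifs
    · exact mul_inv_cancel₀ (hd x)
    · exact mul_zero _
  inv_val := by
    ext x y
    rw [diag_mul_apply, FI.one_def, diag_apply, diag_apply]
    split_ifs
    · exact inv_mul_cancel₀ (hd x)
    · exact mul_zero _

/-! ### Multiplicative automorphisms -/

/-- The elements `σ` of the incidence space that define multiplicative automorphisms. -/
structure IsMultiplicative (σ : X → X → K) : Prop where
  zero : ∀ x y, ¬ x ≤ y → σ x y = 0
  ne_zero : ∀ x y, x ≤ y → σ x y ≠ 0
  mul : ∀ x y z, x ≤ y → y ≤ z → σ x y * σ y z = σ x z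

/-- Entrywise multiplication of an element of `FI(X,K)` by a function. -/
def pointMul (σ : X → X → K) (f : FI X K) : FI X K :=
  ⟨fun x y => σ x y * f x y, fun x y h => by
      dsimp only
      rw [f.2.1 _ _ h, mul_zero],
    fun x y h => (f.2.2 x y h).subset fun _ ⟨h1, h2, h3, h4, h5⟩ =>
      ⟨h1, h2, h3, h4, right_ne_zero_of_mul h5⟩⟩

theorem pointMul_apply (σ : X → X → K) (f : FI X K) (x y : X) :
    pointMul σ f x y = σ x y * f x y := rfl

/-- The multiplicative automorphism `M_σ`, `M_σ(f)(x,y) = σ(x,y) f(x,y)`. -/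
noncomputable def multAut (σ : X → X → K) (hσ : IsMultiplicative σ) : FI X K ≃ₐ[K] FI X K :=
  have h1 : pointMul σ (1 : FI X K) = 1 := by
    ext x y
    rw [pointMul_apply, FI.one_def, diag_apply]
    split_ifs with h
    · subst h
      have h2 := hσ.mul x x x le_rfl le_rfl
      rw [mul_one]
      exact mul_left_cancel₀ (hσ.ne_zero x x le_rfl) (by rw [h2, mul_one])
    · exact mul_zero _
  AlgEquiv.ofLinearEquiv
    { toFun := pointMul σ
      invFun := pointMul fun x y => (σ x y)⁻¹
      map_add' := fun f g => by ext x y; simp [pointMul_apply, mul_add]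
      map_smul' := fun c f => by ext x y; simp [pointMul_apply, mul_left_comm]
      left_inv := fun f => by
        ext x y
        by_cases h : x ≤ y
        · simp [pointMul_apply, hσ.ne_zero x y h]
        · rw [FI.apply_of_not_le _ h, FI.apply_of_not_le _ h]
      right_inv := fun f => by
        ext x y
        by_cases h : x ≤ y
        · simp [pointMul_apply, hσ.ne_zero x y h]
        · rw [FI.apply_of_not_le _ h, FI.apply_of_not_le _ h] }
    h1
    (fun f g => by
      ext x y
      change pointMul σ (f * g) x y = (pointMul σ f * pointMul σ g) x y
      obtain ⟨S, hS⟩ := f.exists_finset' x y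
      rw [pointMul_apply, FI.mul_apply_sum f g S hS,
        FI.mul_apply_sum (pointMul σ f) (pointMul σ g) S
          fun z hz hne => hS z hz (right_ne_zero_of_mul hne), Finset.mul_sum]
      refine Finset.sum_congr rfl fun z _ => ?_
      rw [pointMul_apply, pointMul_apply]
      by_cases hxz : x ≤ z
      · by_cases hzy : z ≤ y
        · rw [← hσ.mul x z y hxz hzy]; ring
        · simp [g.apply_of_not_le hzy]
      · simp [f.apply_of_not_le hxz])

/-- Every multiplicative automorphism of `FI(X,K)` is inner. -/
def MultAutInner (X : Type u) (K : Type v) [PartialOrder X] [Field K] : Prop :=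
  ∀ (σ : X → X → K) (hσ : IsMultiplicative σ), ∃ w : (FI X K)ˣ, ∀ f : FI X K,
    multAut σ hσ f = ↑w * f * ↑w⁻¹

/-! ### Involutions of `FI(X,K)` -/

/-- `ρ` induces `lam` on `X` (`ρ(e_x)` is conjugate to `e_{lam x}` for all `x`) and restricts to
`s` on `K`. -/
structure Induces (ρ : RingInvo (FI X K)) (lam : X → X) (s : RingInvo K) : Prop where
  poset : ∀ x : X, ∃ w : (FI X K)ˣ, (ρ (idem K x)).unop = ↑w * idem K (lam x) * ↑w⁻¹
  field : ∀ a : K, (ρ (algebraMap K (FI X K) a)).unop = algebraMap K (FI X K) (s a).unop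

variable {lam : X → X}

/-- The map `f ↦ ((x,y) ↦ f(lam y, lam x)*)`. -/
def starMap (hlam : IsPosetInvolution lam) (s : RingInvo K) (f : FI X K) : FI X K :=
  ⟨fun x y => (s (f (lam y) (lam x))).unop,
    fun x y h => by
      dsimp only
      rw [f.2.1 _ _ fun h' => h ((hlam.le_iff x y).2 h')]; simp,
    fun x y h => by
      refine ((f.2.2 (lam y) (lam x) ((hlam.le_iff x y).1 h)).image
        (fun p => (lam p.2, lam p.1))).subset ?_
      rintro ⟨p, q⟩ ⟨h1, h2, h3, h4, h5⟩
      refine ⟨(lam q, lam p), ⟨(hlam.le_iff _ _).1 h3, (hlam.le_iff _ _).1 h2,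
        (hlam.le_iff _ _).1 h1, fun e => h4 ?_, fun e => h5 ?_⟩, ?_⟩
      · have := congrArg lam e
        simpa [hlam.invol] using this.symm
      · dsimp only at e ⊢
        rw [e]; simp
      · simp [hlam.invol]⟩

theorem starMap_apply (hlam : IsPosetInvolution lam) (s : RingInvo K) (f : FI X K) (x y : X) :
    starMap hlam s f x y = (s (f (lam y) (lam x))).unop := rfl

theorem starMap_mul (hlam : IsPosetInvolution lam) (s : RingInvo K) (f g : FI X K) :
    starMap hlam s (f * g) = starMap hlam s g * starMap hlam s f := by
  classical
  ext x y
  obtain ⟨S, hS⟩ := f.exists_finset' (lam y) (lam x)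
  obtain ⟨T, hT⟩ := (starMap hlam s g).exists_finset' x y
  have inj : Function.Injective lam := fun a b h => by
    rw [← hlam.invol a, h, hlam.invol]
  rw [starMap_apply, FI.mul_apply_sum f g (S ∪ T.image lam)
      fun z hz hne => Finset.mem_union_left _ (hS z hz hne),
    FI.mul_apply_sum _ _ ((S ∪ T.image lam).image lam) fun z hz hne => by
      refine Finset.mem_image.2 ⟨lam z, Finset.mem_union_right _ ?_, hlam.invol z⟩
      exact Finset.mem_image_of_mem _ (hT z hz hne),
    Finset.sum_image inj.injOn, map_sum, Finset.unop_sum]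
  refine Finset.sum_congr rfl fun z _ => ?_
  rw [unop_map_mul, starMap_apply, starMap_apply, hlam.invol]

/-- The involution `ρ_lam^*` of `FI(X,K)`. -/
noncomputable def rhoStar (hlam : IsPosetInvolution lam) (s : RingInvo K) : RingInvo (FI X K) :=
  RingInvo.mk'
    { toFun := fun f => MulOpposite.op (starMap hlam s f)
      map_one' := by
        rw [← MulOpposite.op_one, MulOpposite.op_inj]
        ext x y
        rw [starMap_apply, FI.one_def, diag_apply, diag_apply]
        by_cases h : x = y
        · simp [h]
        · have h' : lam y ≠ lam x := fun e => h (by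
            rw [← hlam.invol x, ← e, hlam.invol])
          simp [h, h']
      map_zero' := by
        rw [← MulOpposite.op_zero, MulOpposite.op_inj]
        ext x y
        simp [starMap_apply]
      map_add' := fun f g => by
        rw [← MulOpposite.op_add, MulOpposite.op_inj]
        ext x y
        simp [starMap_apply]
      map_mul' := fun f g => by
        rw [← MulOpposite.op_mul, MulOpposite.op_inj]
        exact starMap_mul hlam s f g }
    (fun f => by
      ext x y
      simp [starMap_apply, hlam.invol])

theorem rhoStar_apply (hlam : IsPosetInvolution lam) (s : RingInvo K) (f : FI X K) (x y : X) :
    (rhoStar hlam s f).unop x y = (s (f (lam y) (lam x))).unop := rfl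

open Classical in
/-- The diagonal of `u_ε`: `ε(x)` on the fixed points of `lam` and `1` elsewhere. -/
noncomputable def epsDiag {s : RingInvo K} (ε : FixedSet lam → (fixedField s)ˣ) (x : X) : K :=
  if h : lam x = x then ((ε ⟨x, h⟩ : fixedField s) : K) else 1

theorem epsDiag_ne_zero {s : RingInvo K} (ε : FixedSet lam → (fixedField s)ˣ) (x : X) :
    epsDiag ε x ≠ 0 := by
  unfold epsDiag
  split_ifs
  · simp
  · exact one_ne_zero

/-- The unit `u_ε` of `FI(X,K)`. -/
noncomputable def uEps {s : RingInvo K} (ε : FixedSet lam → (fixedField s)ˣ) : (FI X K)ˣ :=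
  diagUnit (epsDiag ε) (epsDiag_ne_zero ε)

theorem uEps_symmetric (hlam : IsPosetInvolution lam) {s : RingInvo K}
    (ε : FixedSet lam → (fixedField s)ˣ) :
    (rhoStar hlam s (uEps ε : FI X K)).unop = uEps ε := by
  ext x y
  rw [rhoStar_apply]
  change (s (diag (epsDiag ε) (lam y) (lam x))).unop = diag (epsDiag ε) x y
  rw [diag_apply, diag_apply]
  by_cases h : x = y
  · subst h
    rw [if_pos rfl, if_pos rfl]
    unfold epsDiag
    by_cases h' : lam x = x
    · have h'' : lam (lam x) = lam x := by rw [h', h']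
      have e : (⟨lam x, h''⟩ : FixedSet lam) = ⟨x, h'⟩ := Subtype.ext h'
      rw [dif_pos h'', dif_pos h', e]
      exact (ε ⟨x, h'⟩ : fixedField s).2
    · have h'' : lam (lam x) ≠ lam x := by rw [hlam.invol]; exact fun e => h' e.symm
      rw [dif_neg h'', dif_neg h']
      simp
  · have h' : lam y ≠ lam x := fun e => h (by
      rw [← hlam.invol x, ← e, hlam.invol])
    rw [if_neg h, if_neg h']
    simp

/-- The involution `ρ_ε = Ψ_{u_ε} ∘ ρ_lam^*`. -/
noncomputable def rhoEps (hlam : IsPosetInvolution lam) {s : RingInvo K}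
    (ε : FixedSet lam → (fixedField s)ˣ) : RingInvo (FI X K) :=
  conjInvo (rhoStar hlam s) (uEps ε) (uEps_symmetric hlam ε)

/-! ### Classes -/

/-- The classes of maps `X₃ → K₀ˣ/K₁`, where `θ₁` and `θ₂` are equivalent if `θ₁ = L_g ∘ θ₂` for
some `g` in `K₀ˣ/K₁`: the orbits of the pointwise left multiplication action. -/
abbrev ThetaClass (lam : X → X) (s : RingInvo K) : Type _ :=
  MulAction.orbitRel.Quotient (NormQuotient s) (FixedSet lam → NormQuotient s)

/-- The class of `θ_ε = π ∘ ε`, where `π : K₀ˣ → K₀ˣ/K₁` is the projection. -/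
def thetaClass {s : RingInvo K} (ε : FixedSet lam → (fixedField s)ˣ) : ThetaClass lam s :=
  Quotient.mk _ fun x => QuotientGroup.mk (ε x)

/-- The involution `ρ` induces the class `c`: `ρ` is equivalent via inner automorphisms to some
`ρ_ε` such that `c` is the class of `θ_ε`. -/
def InducesClass (hlam : IsPosetInvolution lam) (s : RingInvo K) (ρ : RingInvo (FI X K))
    (c : ThetaClass lam s) : Prop :=
  ∃ ε : FixedSet lam → (fixedField s)ˣ, InnerEquiv ρ (rhoEps hlam ε) ∧ thetaClass ε = c

/-- Equivalence via inner automorphisms on the set of the involutions of `FI(X,K)` that induce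
`lam` on `X` and `s` on `K`. -/
def innerSetoid (lam : X → X) (s : RingInvo K) :
    Setoid {ρ : RingInvo (FI X K) // Induces ρ lam s} where
  r ρ₁ ρ₂ := InnerEquiv ρ₁.1 ρ₂.1
  iseqv := ⟨fun ρ => innerEquiv_refl ρ.1, innerEquiv_symm, innerEquiv_trans⟩

end FI

end FinInc

/-! Write `R` for ρ_λ^*. If ρ induces λ and *, then ρ ∘ R is a K-linear automorphism that sends each
e_x to a conjugate of itself. A single unit undoes all these conjugations at once
(`exists_unit_map_idem_mul`; the difficulty is that this unit be finitary). What remains fixes every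
e_x, so it is multiplicative, hence inner by assumption, and ρ = Ψ_w ∘ R. As X is connected, the
centre is K, so ρ² = id gives w = c R(w) with c a scalar; dividing by the diagonal entry of w at a
fixed point of λ makes w symmetric (`exists_symmetric_unit`).

Inner equivalence thus becomes congruence w ↦ v w R(v) of symmetric units, up to a central factor
(`innerEquiv_iff_exists_central`). Each symmetric unit is congruent to some u_ε: a diagonal
congruence puts 1 on the two-element orbits of λ, and the remaining factor with unit diagonal is
absorbed by a symmetric square root, which exists because 2 ≠ 0 (`exists_congruence_uEps`). At a
fixed point, congruence changes ε(x) by a norm aa*, while the central factor multiplies all of ε by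
one element of K₀. Hence ρ_ε and ρ_ε' are equivalent exactly when θ_ε and θ_ε' are
(`innerEquiv_rhoEps_iff`). Normalising θ to be 1 at one fixed point counts the classes. -/

namespace FinInc

/-! ### Entries of products, matrix units and the centre -/

section Algebra

variable {X : Type u} {K : Type v} [PartialOrder X] [Field K]

theorem mem_finitarySubspace {f : X → X → K} (h0 : ∀ x y, ¬ x ≤ y → f x y = 0)
    (h : ∀ x y, ∃ S : Set X, S.Finite ∧
      ∀ u v, x ≤ u → v ≤ y → f u v ≠ 0 → u ≠ v → u ∈ S ∧ v ∈ S) :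
    f ∈ finitarySubspace X K := by
  refine ⟨h0, fun x y _ => ?_⟩
  obtain ⟨S, hS, hm⟩ := h x y
  refine (hS.prod hS).subset ?_
  rintro ⟨p, q⟩ ⟨h1, -, h3, h4, h5⟩
  exact hm p q h1 h3 h5 h4

@[simp] theorem FI.sub_apply (f g : FI X K) (x y : X) : (f - g) x y = f x y - g x y := rfl

theorem FI.one_apply_self (x : X) : (1 : FI X K) x x = 1 := if_pos rfl

theorem exists_of_mul_ne {f g : FI X K} {x y : X} (h : (f * g) x y ≠ 0) :
    ∃ z, f x z ≠ 0 ∧ g z y ≠ 0 := exists_of_conv_ne f g h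

theorem mul_apply_self (f g : FI X K) (x : X) : (f * g) x x = f x x * g x x := by
  rw [FI.mul_apply_sum f g {x}, Finset.sum_singleton]
  intro z hz hne
  exact Finset.mem_singleton.2 (le_antisymm hz (f.le_of_ne hne))

theorem mul_idem_apply_self (f : FI X K) (x y : X) : (f * idem K y) x y = f x y := by
  rw [idem, mul_diag_apply, if_pos rfl, mul_one]

theorem mul_idem_apply_ne (f : FI X K) (x : X) {y z : X} (h : z ≠ y) :
    (f * idem K y) x z = 0 := by
  rw [idem, mul_diag_apply, if_neg h, mul_zero]

theorem idem_mul_apply_self (f : FI X K) (x y : X) : (idem K x * f) x y = f x y := by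
  rw [idem, diag_mul_apply, if_pos rfl, one_mul]

theorem idem_mul_apply_ne (f : FI X K) {x z : X} (y : X) (h : z ≠ x) :
    (idem K x * f) z y = 0 := by
  rw [idem, diag_mul_apply, if_neg h, zero_mul]

theorem mul_idem_mul_apply (f g : FI X K) (z x y : X) :
    (f * idem K z * g) x y = f x z * g z y := by
  rw [FI.mul_apply_sum (f * idem K z) g {z}, Finset.sum_singleton, mul_idem_apply_self]
  intro a _ hne
  by_contra h
  exact hne (mul_idem_apply_ne f x (by simpa using h))

theorem diag_mul_diag (d d' : X → K) : diag d * diag d' = diag fun x => d x * d' x := by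
  ext x y
  rw [diag_mul_apply, diag_apply, diag_apply]
  split_ifs <;> simp

theorem diag_mul_idem (d : X → K) (x : X) : diag d * idem K x = d x • idem K x := by
  ext a b
  rw [diag_mul_apply, FI.smul_apply, idem, diag_apply]
  by_cases h : a = b <;> by_cases h' : a = x <;> simp [h, h']
  · subst h; simp [h']
  · subst h; simp [h']

theorem algebraMap_eq_diag (c : K) : algebraMap K (FI X K) c = diag fun _ => c := by
  rw [Algebra.algebraMap_eq_smul_one, smul_eq_diag_mul, mul_one]

theorem unit_apply_self_mul (w : (FI X K)ˣ) (x : X) :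
    (w : FI X K) x x * (↑w⁻¹ : FI X K) x x = 1 := by
  rw [← mul_apply_self, Units.mul_inv, FI.one_apply_self]

theorem unit_apply_self_ne_zero (w : (FI X K)ˣ) (x : X) : (w : FI X K) x x ≠ 0 :=
  left_ne_zero_of_mul_eq_one (unit_apply_self_mul w x)

/-- The matrix unit `e_{xy}`, for `x ≤ y`. -/
theorem exists_matrixUnit (K : Type v) [Field K] {x y : X} (h : x ≤ y) :
    ∃ e : FI X K, e x y = 1 ∧ ∀ u v, e u v ≠ 0 → u = x ∧ v = y := by
  classical
  refine ⟨⟨fun u v => if u = x ∧ v = y then 1 else 0, mem_finitarySubspace ?_ ?_⟩, ?_, ?_⟩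
  · intro u v huv
    exact if_neg fun ⟨e1, e2⟩ => huv (e1 ▸ e2 ▸ h)
  · intro _ _
    refine ⟨{x, y}, Set.toFinite _, fun u v _ _ hne _ => ?_⟩
    obtain ⟨rfl, rfl⟩ : u = x ∧ v = y := by
      by_contra hc
      exact hne (if_neg hc)
    simp
  · exact if_pos ⟨rfl, rfl⟩
  · intro u v hne
    by_contra hc
    exact hne (if_neg hc)

/-- Commuting with the e_x kills the off-diagonal entries, commuting with e_xy equates the diagonal
entries at x and y, and connectedness propagates this equality. -/
theorem eq_algebraMap_of_commute (hX : ConnectedPoset X) [Nonempty X] (f : FI X K)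
    (hf : ∀ g, f * g = g * f) : ∃ c : K, f = algebraMap K (FI X K) c := by
  have hoff : ∀ x y, x ≠ y → f x y = 0 := fun x y h => by
    rw [← mul_idem_apply_self, hf, idem_mul_apply_ne _ _ h]
  have hle : ∀ x y, x ≤ y → f x x = f y y := fun x y h => by
    obtain ⟨e, he, he'⟩ := exists_matrixUnit K h
    have key := congrArg (fun g : FI X K => g x y) (hf e)
    have h1 : (f * e) x y = f x x := by
      rw [FI.mul_apply_sum f e {x}, Finset.sum_singleton, he, mul_one]
      intro z _ hne
      by_contra hz
      exact hne (hoff x z fun e => hz (by simp [e]))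
    have h2 : (e * f) x y = f y y := by
      rw [FI.mul_apply_sum e f {y}, Finset.sum_singleton, he, one_mul]
      intro z _ hne
      simp [(he' _ _ hne).2]
    simpa only [h1, h2] using key
  obtain ⟨x₀⟩ := ‹Nonempty X›
  refine ⟨f x₀ x₀, ?_⟩
  rw [algebraMap_eq_diag]
  have hc : ∀ x, f x x = f x₀ x₀ := fun x => by
    induction hX x₀ x with
    | refl => rfl
    | tail _ h ih =>
      rw [← ih]
      rcases h with h | h
      · exact (hle _ _ h).symm
      · exact hle _ _ h
  ext x y
  rw [diag_apply]
  split_ifs with h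
  · rw [← h, hc]
  · exact hoff x y h

/-! ### Limits on intervals: geometric and Catalan series -/

/-- Two elements have the same restriction to the interval `[x, y]`. -/
def AgreeOn (x y : X) (f g : FI X K) : Prop := ∀ u v, x ≤ u → v ≤ y → f u v = g u v

theorem AgreeOn.symm {x y : X} {f g : FI X K} (h : AgreeOn x y f g) : AgreeOn x y g f :=
  fun u v hu hv => (h u v hu hv).symm

theorem AgreeOn.trans {x y : X} {f g k : FI X K} (h : AgreeOn x y f g) (h' : AgreeOn x y g k) :
    AgreeOn x y f k :=
  fun u v hu hv => (h u v hu hv).trans (h' u v hu hv)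

theorem AgreeOn.mul {x y : X} {f f' g g' : FI X K} (h : AgreeOn x y f f')
    (h' : AgreeOn x y g g') : AgreeOn x y (f * g) (f' * g') := by
  intro u v hu hv
  rw [FI.mul_apply, FI.mul_apply]
  refine finsum_mem_congr rfl fun z hz => ?_
  rw [h u z hu (hz.2.trans hv), h' z v (hu.trans hz.1) hv]

theorem eq_of_agreeOn {f g : FI X K} (h : ∀ x y, AgreeOn x y f g) : f = g := by
  ext x y
  exact h x y x y le_rfl le_rfl

/-- An element with zero diagonal is locally nilpotent. -/
theorem exists_pow_mul_apply_eq_zero {t : FI X K} (ht : ∀ x, t x x = 0) (x y : X) :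
    ∃ N, ∀ n, N ≤ n → ∀ (h : FI X K) (u v), x ≤ u → v ≤ y → (t ^ n * h) u v = 0 := by
  classical
  obtain ⟨S, hS⟩ := t.exists_finset x y
  -- Each factor t moves strictly up from u to another point of S, so n is at most the number of
  -- points of S above u.
  have key : ∀ n (h : FI X K) (u v), x ≤ u → v ≤ y → (t ^ n * h) u v ≠ 0 →
      n ≤ (S.filter (u < ·)).card := by
    intro n
    induction n with
    | zero => intros; exact Nat.zero_le _
    | succ n ih =>
      intro h u v hu hv hne
      rw [pow_succ', mul_assoc] at hne
      obtain ⟨z, h1, h2⟩ := exists_of_mul_ne hne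
      have huz := t.le_of_ne h1
      have hzv := FI.le_of_ne _ h2
      have hne' : u ≠ z := fun e => h1 (by rw [← e, ht])
      have hlt : u < z := lt_of_le_of_ne huz hne'
      refine Nat.succ_le_of_lt ((ih h z v (hu.trans huz) hv h2).trans_lt
        (Finset.card_lt_card ?_))
      refine Finset.ssubset_iff.2 ⟨z, by simp, fun a ha => ?_⟩
      rcases Finset.mem_insert.1 ha with rfl | ha
      · exact Finset.mem_filter.2 ⟨(hS u a hu (hzv.trans hv) h1 hne').2, hlt⟩
      · rw [Finset.mem_filter] at ha ⊢
        exact ⟨ha.1, hlt.trans ha.2⟩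
  refine ⟨S.card + 1, fun n hn h u v hu hv => ?_⟩
  by_contra hne
  have := (key n h u v hu hv hne).trans (Finset.card_filter_le _ _)
  omega

/-- A sequence whose `n`-th increment is a multiple of `t ^ n`, with `t` of zero diagonal,
is locally eventually constant and has a limit. -/
theorem exists_limit {t : FI X K} (ht : ∀ x, t x x = 0) (F : ℕ → FI X K)
    (hF : ∀ n, ∃ h, F (n + 1) - F n = t ^ n * h) :
    ∃ L : FI X K, ∀ x y, ∃ N, ∀ n, N ≤ n → AgreeOn x y L (F n) := by
  have hst : ∀ x y, ∃ N, ∀ n, N ≤ n → AgreeOn x y (F n) (F N) := by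
    intro x y
    obtain ⟨N, hN⟩ := exists_pow_mul_apply_eq_zero ht x y
    refine ⟨N, fun n hn => ?_⟩
    induction n, hn using Nat.le_induction with
    | base => exact fun _ _ _ _ => rfl
    | succ n hn ih =>
      obtain ⟨h, hh⟩ := hF n
      refine AgreeOn.trans (fun u v hu hv => ?_) ih
      rw [← sub_eq_zero, ← FI.sub_apply, hh, hN n hn h u v hu hv]
  choose N hN using hst
  -- Compare both terms at a common later index. The entrywise limit therefore coincides with the
  -- single element `F (N x y)` on all of [x, y], which makes it finitary.
  have hag : ∀ x y u v, x ≤ u → v ≤ y → F (N u v) u v = F (N x y) u v := by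
    intro x y u v hu hv
    rw [← hN u v (max (N u v) (N x y)) (le_max_left _ _) u v le_rfl le_rfl,
      hN x y (max (N u v) (N x y)) (le_max_right _ _) u v hu hv]
  refine ⟨⟨fun u v => F (N u v) u v, mem_finitarySubspace
    (fun u v h => FI.apply_of_not_le _ h) fun x y => ?_⟩, fun x y => ⟨N x y, fun n hn => ?_⟩⟩
  · obtain ⟨S, hS⟩ := (F (N x y)).exists_finset x y
    refine ⟨S, S.finite_toSet, fun u v hu hv hne huv => ?_⟩
    exact hS u v hu hv (by rwa [hag x y u v hu hv] at hne) huv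
  · intro u v hu hv
    exact (hag x y u v hu hv).trans (hN x y n hn u v hu hv).symm

/-- The inverse of 1 - t is the limit of the partial sums of its geometric series, since 1 - t^n is
eventually 1 on each interval. -/
theorem exists_geometric {t : FI X K} (ht : ∀ x, t x x = 0) :
    ∃ b : FI X K, (1 - t) * b = 1 ∧ b * (1 - t) = 1 := by
  obtain ⟨b, hb⟩ := exists_limit ht (fun n => ∑ k ∈ Finset.range n, t ^ k)
    fun n => ⟨1, by rw [Finset.sum_range_succ, add_sub_cancel_left, mul_one]⟩
  have hz : ∀ x y, ∃ N, ∀ n, N ≤ n → AgreeOn x y (1 - t ^ n) 1 := fun x y => by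
    obtain ⟨N, hN⟩ := exists_pow_mul_apply_eq_zero ht x y
    refine ⟨N, fun n hn u v hu hv => ?_⟩
    rw [FI.sub_apply, ← mul_one (t ^ n), hN n hn 1 u v hu hv, sub_zero]
  refine ⟨b, eq_of_agreeOn fun x y => ?_, eq_of_agreeOn fun x y => ?_⟩ <;>
  · obtain ⟨N, hN⟩ := hb x y
    obtain ⟨M, hM⟩ := hz x y
    have h1 := hN (max N M) (le_max_left _ _)
    have h2 := hM (max N M) (le_max_right _ _)
    first
    | have h3 := AgreeOn.mul (f := 1 - t) (fun _ _ _ _ => rfl) h1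
      rw [mul_neg_geom_sum] at h3
      exact h3.trans h2
    | have h3 := AgreeOn.mul (g := 1 - t) h1 (fun _ _ _ _ => rfl)
      rw [geom_sum_mul_neg] at h3
      exact h3.trans h2

theorem isUnit_of_apply_self_eq_one {f : FI X K} (hf : ∀ x, f x x = 1) : IsUnit f := by
  obtain ⟨b, h1, h2⟩ := exists_geometric (t := 1 - f) fun x => by
    rw [FI.sub_apply, hf, FI.one_apply_self, sub_self]
  rw [sub_sub_cancel] at h1 h2
  exact ⟨⟨f, b, h1, h2⟩, rfl⟩

/-- The equation `c = 1 + t c²` of the generating function of the Catalan numbers. -/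
theorem exists_catalan {t : FI X K} (ht : ∀ x, t x x = 0) :
    ∃ c : FI X K, Commute t c ∧ c = 1 + t * (c * c) ∧
      ∀ τ : RingInvo (FI X K), (τ t).unop = t →
        (∀ x y, ∃ x' y', ∀ f g : FI X K, AgreeOn x' y' f g →
          (τ f).unop x y = (τ g).unop x y) → (τ c).unop = c := by
  obtain ⟨F, hF0, hFs⟩ : ∃ F : ℕ → FI X K, F 0 = 1 ∧ ∀ n, F (n + 1) = 1 + t * (F n * F n) :=
    ⟨fun n => Nat.rec 1 (fun _ c => 1 + t * (c * c)) n, rfl, fun _ => rfl⟩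
  have hcom : ∀ n, Commute t (F n) := fun n => by
    induction n with
    | zero => exact hF0 ▸ Commute.one_right t
    | succ n ih =>
      rw [hFs]
      exact (Commute.one_right t).add_right ((Commute.refl t).mul_right (ih.mul_right ih))
  have hcomF : ∀ n, Commute (F n) (F (n + 1)) := fun n => by
    rw [hFs]
    exact (Commute.one_right _).add_right ((hcom n).symm.mul_right
      ((Commute.refl _).mul_right (Commute.refl _)))
  -- The iterates commute, so F(n+2) - F(n+1) = t (F(n+1) + F(n)) (F(n+1) - F(n)): each increment
  -- gains a factor t.
  obtain ⟨c, hc⟩ := exists_limit ht F fun n => by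
    induction n with
    | zero => exact ⟨F 1 - F 0, by simp⟩
    | succ n ih =>
      obtain ⟨h, hh⟩ := ih
      refine ⟨(F (n + 1) + F n) * h, ?_⟩
      have e : F (n + 1 + 1) - F (n + 1) = t * ((F (n + 1) + F n) * (F (n + 1) - F n)) := by
        rw [congrArg₂ (· - ·) (hFs (n + 1)) (hFs n), add_sub_add_left_eq_sub, ← mul_sub,
          (hcomF n).symm.mul_self_sub_mul_self_eq]
      rw [e, hh, pow_succ', mul_assoc t, ← mul_assoc _ (t ^ n),
        ← mul_assoc (t ^ n) (F (n + 1) + F n)]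
      congr 2
      exact (((hcom (n + 1)).add_right (hcom n)).pow_left n).eq.symm
  refine ⟨c, eq_of_agreeOn fun x y => ?_, eq_of_agreeOn fun x y => ?_, fun τ hτ hloc => ?_⟩
  · obtain ⟨N, hN⟩ := hc x y
    have h1 := AgreeOn.mul (f := t) (fun _ _ _ _ => rfl) (hN N le_rfl)
    have h2 := AgreeOn.mul (g := t) (hN N le_rfl) (fun _ _ _ _ => rfl)
    rw [(hcom N).eq] at h1
    exact h1.trans h2.symm
  · obtain ⟨N, hN⟩ := hc x y
    have h1 := hN N le_rfl
    have h2 := AgreeOn.mul (f := t) (fun _ _ _ _ => rfl) (h1.mul h1)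
    refine (hN (N + 1) (Nat.le_succ N)).trans fun u v hu hv => ?_
    rw [hFs, FI.add_apply, FI.add_apply, h2 u v hu hv]
  -- The iterates are polynomials in t, hence fixed by τ. Locality of τ, that each entry of τ(f)
  -- depends on f over one interval only, carries this to the limit.
  · have hτF : ∀ n, (τ (F n)).unop = F n := fun n => by
      induction n with
      | zero => rw [hF0, map_one, MulOpposite.unop_one]
      | succ n ih =>
        rw [hFs, map_add, map_one, MulOpposite.unop_add, MulOpposite.unop_one, unop_map_mul,
          unop_map_mul, ih, hτ, ((hcom n).mul_right (hcom n)).eq]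
    ext x y
    obtain ⟨x', y', h⟩ := hloc x y
    obtain ⟨N, hN⟩ := hc x y
    obtain ⟨M, hM⟩ := hc x' y'
    rw [h _ _ (hM (max N M) (le_max_right _ _)), hτF,
      hN (max N M) (le_max_left _ _) x y le_rfl le_rfl]

end Algebra

/-- An infinite fibre of u in V will do: its only value a lies outside it, because u moves a if a ∈
V. If all fibres are finite, a finite selection rules out only finitely many further points, so a
sequence can be chosen greedily. -/
theorem exists_infinite_independent {Y : Type*} {V : Set Y} (hV : V.Infinite) (u : Y → Y)
    (hu : ∀ v ∈ V, u v ≠ v) : ∃ A ⊆ V, A.Infinite ∧ ∀ v ∈ A, u v ∉ A := by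
  classical
  by_cases h : ∃ a, (V ∩ u ⁻¹' {a}).Infinite
  · obtain ⟨a, ha⟩ := h
    refine ⟨_, Set.inter_subset_left, ha, fun v hv hv' => ?_⟩
    have h1 : u v = a := hv.2
    rw [h1] at hv'
    exact hu a hv'.1 hv'.2
  · simp only [not_exists, Set.not_infinite] at h
    have : Std.Symm (fun v w : Y => v ≠ w ∧ u v ≠ w ∧ u w ≠ v) :=
      ⟨fun _ _ ⟨h1, h2, h3⟩ => ⟨h1.symm, h3, h2⟩⟩
    obtain ⟨f, hf, hr⟩ := exists_seq_of_forall_finset_exists' (fun v => v ∈ V)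
      (fun v w => v ≠ w ∧ u v ≠ w ∧ u w ≠ v) fun s _ => by
        have hfin : ((s : Set Y) ∪ (u '' s ∪ ⋃ a ∈ s, V ∩ u ⁻¹' {a})).Finite :=
          s.finite_toSet.union ((s.finite_toSet.image u).union
            (s.finite_toSet.biUnion fun a _ => h a))
        obtain ⟨w, hw, hw'⟩ := (hV.sdiff hfin).nonempty
        refine ⟨w, hw, fun a ha => ⟨?_, ?_, ?_⟩⟩
        · rintro rfl
          exact hw' (Or.inl ha)
        · exact fun e => hw' (Or.inr (Or.inl ⟨a, ha, e⟩))
        · exact fun e => hw' (Or.inr (Or.inr (Set.mem_biUnion ha ⟨hw, e⟩)))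
    have hinj : Function.Injective f := fun m n e => by
      by_contra hmn
      exact (hr hmn).1 e
    refine ⟨Set.range f, by rintro _ ⟨n, rfl⟩; exact hf n, Set.infinite_range_of_injective hinj, ?_⟩
    rintro _ ⟨m, rfl⟩ ⟨n, hn⟩
    by_cases hmn : m = n
    · exact hu _ (hf m) (hmn ▸ hn.symm)
    · exact (hr hmn).2.1 hn.symm

/-! ### Symmetric square roots -/

section Algebra

variable {X : Type u} {K : Type v} [PartialOrder X] [Field K]

/-- With t = (1 - r)/4 and c = 1 + t c², the element q = 1 - 2tc has square 1 - 4t = r. The Catalan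
series has integer coefficients, so only 2 need be invertible, whatever the characteristic. -/
theorem exists_symmetric_sqrt (h2 : (2 : K) ≠ 0) {r : FI X K} (hr : ∀ x, r x x = 1) :
    ∃ q : FI X K, q * q = r ∧
      ∀ τ : RingInvo (FI X K), (τ r).unop = r →
        (∀ x y, ∃ x' y', ∀ f g : FI X K, AgreeOn x' y' f g →
          (τ f).unop x y = (τ g).unop x y) → (τ q).unop = q := by
  have h4 : (4 : K) ≠ 0 := by
    have := mul_ne_zero h2 h2
    norm_num at this
    exact this
  set t : FI X K := (4 : K)⁻¹ • (1 - r) with ht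
  have h4t : 4 • t = 1 - r := by
    ext x y
    rw [← Nat.cast_smul_eq_nsmul K, FI.smul_apply, ht, FI.smul_apply]
    push_cast
    rw [mul_inv_cancel_left₀ h4]
  have inj : ∀ f g : FI X K, 4 • f = 4 • g → f = g := fun f g h => by
    ext x y
    have := congrArg (fun k : FI X K => k x y) h
    simp only [← Nat.cast_smul_eq_nsmul K, FI.smul_apply] at this
    push_cast at this
    exact mul_left_cancel₀ h4 this
  obtain ⟨c, hcom, hc, hτ⟩ := exists_catalan (t := t) fun x => by
    rw [ht, FI.smul_apply, FI.sub_apply, hr, FI.one_apply_self, sub_self, mul_zero]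
  have ha : t * c * (t * c) = t * c - t := by
    calc t * c * (t * c) = t * (t * (c * c)) := by
          rw [mul_assoc, ← mul_assoc c, ← hcom.eq, mul_assoc]
      _ = t * (c - 1) := by
          congr 1
          rw [eq_sub_iff_add_eq', ← hc]
      _ = t * c - t := by rw [mul_sub, mul_one]
  refine ⟨1 - 2 • (t * c), ?_, fun τ hr' hloc => ?_⟩
  · have e : (1 - 2 • (t * c)) * (1 - 2 • (t * c)) =
        1 - 4 • (t * c) + 4 • (t * c * (t * c)) := by
      noncomm_ring
    rw [e, ha, smul_sub, h4t]
    abel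
  · have ht' : (τ t).unop = t := by
      apply inj
      rw [← MulOpposite.unop_smul, ← map_nsmul, h4t, map_sub, map_one, MulOpposite.unop_sub,
        hr', MulOpposite.unop_one]
    rw [map_sub, map_one, map_nsmul, MulOpposite.unop_sub, MulOpposite.unop_one,
      MulOpposite.unop_smul, unop_map_mul, ht', hτ τ ht' hloc, hcom.eq]

/-! ### Automorphisms sending each e_x to a conjugate of itself are inner -/

section Automorphism

variable {Φ : FI X K ≃ₐ[K] FI X K}

theorem map_idem_apply_self
    (hΦ : ∀ x, ∃ w : (FI X K)ˣ, Φ (idem K x) = ↑w * idem K x * ↑w⁻¹) (v : X) :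
    Φ (idem K v) v v = 1 := by
  obtain ⟨w, hw⟩ := hΦ v
  rw [hw, mul_idem_mul_apply, unit_apply_self_mul]

theorem map_diag_mul_map_idem (Φ : FI X K ≃ₐ[K] FI X K) (d : X → K) (v : X) :
    Φ (diag d) * Φ (idem K v) = d v • Φ (idem K v) := by
  rw [← map_mul, diag_mul_idem, map_smul]

/-- Compare the (v, v) entries in Φ(d) Φ(e_v) = d(v) Φ(e_v), where Φ(e_v) has entry 1. -/
theorem map_diag_apply_self
    (hΦ : ∀ x, ∃ w : (FI X K)ˣ, Φ (idem K x) = ↑w * idem K x * ↑w⁻¹) (d : X → K) (v : X) :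
    Φ (diag d) v v = d v := by
  have := congrArg (fun f : FI X K => f v v) (map_diag_mul_map_idem Φ d v)
  simpa only [mul_apply_self, FI.smul_apply, map_idem_apply_self hΦ, mul_one] using this

/-- This makes the matrix whose v-th column is that of Φ(e_v) finitary. Otherwise infinitely many
columns v have a nonzero entry above the diagonal; let u(v) be a maximal row of such an entry. For
an infinite set A of these v with u(v) ∉ A for v ∈ A, the image of the indicator of A is nonzero at
every (u(v), v), against its finitarity on [x, y]. -/
theorem finite_map_idem_ne
    (hΦ : ∀ x, ∃ w : (FI X K)ˣ, Φ (idem K x) = ↑w * idem K x * ↑w⁻¹) (x y : X) :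
    {p : X × X | x ≤ p.1 ∧ p.1 < p.2 ∧ p.2 ≤ y ∧ Φ (idem K p.2) p.1 p.2 ≠ 0}.Finite := by
  classical
  by_contra hB
  set W : X → Set X := fun v => {a | x ≤ a ∧ a < v ∧ Φ (idem K v) a v ≠ 0} with hW
  have hWfin : ∀ v, (W v).Finite := fun v => by
    obtain ⟨S, hS⟩ := (Φ (idem K v)).exists_finset x v
    exact S.finite_toSet.subset fun a ha => (hS a v ha.1 le_rfl ha.2.2 ha.2.1.ne).1
  set V : Set X := {v | v ≤ y ∧ (W v).Nonempty} with hV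
  -- Each column contributes finitely many pairs, so infinitely many pairs need infinitely many
  -- columns.
  have hVinf : V.Infinite := fun hfin => hB <| by
    refine ((hfin.biUnion fun v _ => (hWfin v).image fun a => (a, v))).subset ?_
    rintro ⟨a, v⟩ ⟨h1, h2, h3, h4⟩
    exact Set.mem_biUnion (x := v) ⟨h3, a, h1, h2, h4⟩ ⟨a, ⟨h1, h2, h4⟩, rfl⟩
  have hmax : ∀ v, ∃ a, v ∈ V → a ∈ W v ∧ ∀ b ∈ W v, ¬ a < b := fun v => by
    by_cases hv : v ∈ V
    · obtain ⟨a, ha⟩ := (hWfin v).exists_maximal hv.2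
      exact ⟨a, fun _ => ⟨ha.1, fun b hb => ha.not_gt hb⟩⟩
    · exact ⟨v, fun h => absurd h hv⟩
  choose u hu using hmax
  obtain ⟨A, hAV, hAinf, hA⟩ := exists_infinite_independent hVinf u
    fun v hv => (hu v hv).1.2.1.ne
  obtain ⟨S, hS⟩ := (Φ (diag fun z => if z ∈ A then 1 else 0)).exists_finset x y
  obtain ⟨v, hvA, hvS⟩ := (hAinf.sdiff S.finite_toSet).nonempty
  obtain ⟨⟨h1, h2, h3⟩, h4⟩ := hu v (hAV hvA)
  have hne : (Φ (diag fun z => if z ∈ A then 1 else 0) * Φ (idem K v)) (u v) v ≠ 0 := by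
    rw [map_diag_mul_map_idem, FI.smul_apply, if_pos hvA, one_mul]
    exact h3
  -- Here z = u(v) is excluded by u(v) ∉ A, and u(v) < z < v by maximality of u(v). So z = v, which
  -- would put v in S.
  obtain ⟨z, hz1, hz2⟩ := exists_of_mul_ne hne
  have huz := FI.le_of_ne _ hz1
  rcases eq_or_lt_of_le huz with e | hlt
  · rw [← e, map_diag_apply_self hΦ, if_neg (hA v hvA)] at hz1
    exact hz1 rfl
  · have hzv := FI.le_of_ne _ hz2
    rcases eq_or_lt_of_le hzv with e | hlt'
    · rw [e] at hz1
      exact hvS (hS _ _ h1 (hAV hvA).1 hz1 h2.ne).2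
    · exact h4 z ⟨h1.trans huz, hlt', hz2⟩ hlt

theorem idem_mul_idem (x y : X) [Decidable (x = y)] :
    idem K x * idem K y = if x = y then idem K y else 0 := by
  ext a b
  by_cases h : a = x
  · subst h
    rw [idem_mul_apply_self, idem, diag_apply]
    by_cases h' : a = y
    · subst h'
      simp [diag_apply]
    · simp [h']
  · rw [idem_mul_apply_ne _ _ h, idem]
    split_ifs with h'
    · rw [diag_apply]
      simp [← h', h]
    · rfl

/-- The idempotents `Φ(e_x)` are simultaneously conjugate to the `e_x`. -/
theorem exists_unit_map_idem_mul
    (hΦ : ∀ x, ∃ w : (FI X K)ˣ, Φ (idem K x) = ↑w * idem K x * ↑w⁻¹) :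
    ∃ b : (FI X K)ˣ, ∀ x, Φ (idem K x) * b = b * idem K x := by
  classical
  obtain ⟨β, hβ⟩ : ∃ β : FI X K, ∀ x y, β x y = Φ (idem K y) x y := by
    refine ⟨⟨fun x y => Φ (idem K y) x y, mem_finitarySubspace
      (fun x y h => FI.apply_of_not_le _ h) fun x y => ?_⟩, fun _ _ => rfl⟩
    have hfin := finite_map_idem_ne hΦ x y
    refine ⟨_, (hfin.image Prod.fst).union (hfin.image Prod.snd), fun a b ha hb hne hab => ?_⟩
    have hm := And.intro ha (And.intro (lt_of_le_of_ne (FI.le_of_ne _ hne) hab)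
      (And.intro hb hne))
    exact ⟨Or.inl ⟨(a, b), hm, rfl⟩, Or.inr ⟨(a, b), hm, rfl⟩⟩
  obtain ⟨b, rfl⟩ := isUnit_of_apply_self_eq_one (f := β) fun x => by
    rw [hβ, map_idem_apply_self hΦ]
  refine ⟨b, fun v => ?_⟩
  ext x y
  -- Column y of a product depends only on column y of the right factor, and b has the column y of
  -- Φ(e_y) there. Orthogonality of the Φ(e_x) then gives the claim.
  have h1 : (Φ (idem K v) * (b : FI X K)) x y = (Φ (idem K v) * Φ (idem K y)) x y := by
    rw [FI.mul_apply, FI.mul_apply]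
    exact finsum_mem_congr rfl fun z _ => by rw [hβ]
  rw [h1, ← map_mul, idem_mul_idem]
  split_ifs with h
  · rw [h, mul_idem_apply_self, hβ]
  · rw [map_zero, mul_idem_apply_ne _ _ (Ne.symm h), FI.zero_apply]

/-- An automorphism that fixes all the `e_x` is multiplicative. -/
theorem exists_eq_multAut (hΦ : ∀ x, Φ (idem K x) = idem K x) :
    ∃ (σ : X → X → K) (hσ : IsMultiplicative σ), ∀ f, Φ f = multAut σ hσ f := by
  classical
  have hE : ∀ x y : X, ∃ e : FI X K, x ≤ y → e x y = 1 ∧ ∀ u v, e u v ≠ 0 → u = x ∧ v = y :=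
    fun x y => by
      by_cases h : x ≤ y
      · obtain ⟨e, he⟩ := exists_matrixUnit K h
        exact ⟨e, fun _ => he⟩
      · exact ⟨0, fun h' => absurd h' h⟩
  choose E hE using hE
  -- Cutting by e_x and e_y isolates one entry. Since Φ fixes both idempotents, each entry of Φ(f)
  -- is the corresponding entry of f times a factor independent of f.
  have hcut : ∀ (f : FI X K) x y, x ≤ y → idem K x * f * idem K y = f x y • E x y := by
    intro f x y hxy
    obtain ⟨h1, h2⟩ := hE x y hxy
    ext a b
    rw [FI.smul_apply]
    by_cases h : a = x ∧ b = y
    · obtain ⟨rfl, rfl⟩ := h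
      rw [mul_idem_apply_self, idem_mul_apply_self, h1, mul_one]
    · have h0 : E x y a b = 0 := by
        by_contra hne
        exact h (h2 _ _ hne)
      rw [h0, mul_zero]
      by_cases hb : b = y
      · rw [hb, mul_idem_apply_self, idem_mul_apply_ne _ _ fun ha => h ⟨ha, hb⟩]
      · rw [mul_idem_apply_ne _ _ hb]
  have hcutΦ : ∀ (f : FI X K) x y, x ≤ y →
      idem K x * Φ f * idem K y = f x y • Φ (E x y) := by
    intro f x y hxy
    rw [← map_smul, ← hcut f x y hxy, map_mul, map_mul, hΦ, hΦ]
  have hσ1 : ∀ (f : FI X K) x y, x ≤ y → Φ f x y = Φ (E x y) x y * f x y := by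
    intro f x y hxy
    have := congrArg (fun g : FI X K => g x y) (hcutΦ f x y hxy)
    simp only [mul_idem_apply_self, idem_mul_apply_self, FI.smul_apply] at this
    rw [this, mul_comm]
  have hsupp : ∀ x y, x ≤ y → ∀ a b, Φ (E x y) a b ≠ 0 → a = x ∧ b = y := by
    intro x y hxy a b hne
    have h := hσ1 (E x y) a b (FI.le_of_ne _ hne)
    rw [h] at hne
    exact (hE x y hxy).2 a b (right_ne_zero_of_mul hne)
  have hσ : IsMultiplicative fun x y => if x ≤ y then Φ (E x y) x y else 0 := by
    refine ⟨fun x y h => if_neg h, fun x y h => ?_, fun x y z hxy hyz => ?_⟩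
    · rw [if_pos h]
      intro h0
      have hz : Φ (E x y) = 0 := by
        ext a b
        by_contra hne
        obtain ⟨rfl, rfl⟩ := hsupp x y h a b hne
        exact hne h0
      rw [map_eq_zero_iff Φ Φ.injective] at hz
      have := (hE x y h).1
      rw [hz] at this
      exact zero_ne_one this
    · have hprod : ∀ f g : FI X K, (∀ a b, f a b ≠ 0 → a = x ∧ b = y) →
          (f * g) x z = f x y * g y z := fun f g hf => by
        rw [FI.mul_apply_sum f g {y}, Finset.sum_singleton]
        intro w _ hw
        exact Finset.mem_singleton.2 (hf _ _ hw).2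
      rw [if_pos hxy, if_pos hyz, if_pos (hxy.trans hyz), ← hprod _ _ (hsupp x y hxy), ← map_mul,
        hσ1 _ _ _ (hxy.trans hyz), hprod _ _ (hE x y hxy).2, (hE x y hxy).1, (hE y z hyz).1,
        mul_one, mul_one]
  refine ⟨_, hσ, fun f => ?_⟩
  ext x y
  change _ = (if x ≤ y then Φ (E x y) x y else 0) * f x y
  by_cases h : x ≤ y
  · rw [if_pos h, hσ1 f x y h]
  · rw [if_neg h, zero_mul, FI.apply_of_not_le _ h]

/-- Conjugation by a unit, as an algebra automorphism. -/
noncomputable def conjAlgEquiv (w : (FI X K)ˣ) : FI X K ≃ₐ[K] FI X K where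
  toFun f := ↑w * f * ↑w⁻¹
  invFun f := ↑w⁻¹ * f * ↑w
  left_inv f := by simp [mul_assoc]
  right_inv f := by simp [mul_assoc]
  map_mul' f g := by simp [mul_assoc]
  map_add' f g := by simp [mul_add, add_mul]
  commutes' c := by rw [← Algebra.commutes c, mul_assoc, Units.mul_inv, mul_one]

theorem conjAlgEquiv_apply (w : (FI X K)ˣ) (f : FI X K) :
    conjAlgEquiv w f = ↑w * f * ↑w⁻¹ := rfl

/-- Conjugating Φ by the inverse of the common unit b makes it fix every e_x, hence multiplicative,
hence inner by `hM`. -/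
theorem exists_eq_conj (hM : MultAutInner X K)
    (hΦ : ∀ x, ∃ w : (FI X K)ˣ, Φ (idem K x) = ↑w * idem K x * ↑w⁻¹) :
    ∃ w : (FI X K)ˣ, ∀ f, Φ f = ↑w * f * ↑w⁻¹ := by
  obtain ⟨b, hb⟩ := exists_unit_map_idem_mul hΦ
  obtain ⟨σ, hσ, h⟩ := exists_eq_multAut (Φ := Φ.trans (conjAlgEquiv b⁻¹)) fun x => by
    rw [AlgEquiv.trans_apply, conjAlgEquiv_apply, inv_inv, mul_assoc, hb,
      Units.inv_mul_cancel_left]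
  obtain ⟨w, hw⟩ := hM σ hσ
  refine ⟨b * w, fun f => ?_⟩
  have h1 := h f
  rw [hw, AlgEquiv.trans_apply, conjAlgEquiv_apply, inv_inv] at h1
  calc Φ f = ↑b * (↑b⁻¹ * Φ f * ↑b) * ↑b⁻¹ := by simp [mul_assoc]
    _ = ↑(b * w) * f * ↑(b * w)⁻¹ := by rw [h1]; simp [mul_assoc]

end Automorphism

end Algebra

/-! ### Congruence of units with respect to an involution -/

section InvolutionUnits

variable {A : Type*} [Ring A]

/-- The image of a unit under an involution. -/
def invoUnit (ρ : RingInvo A) (w : Aˣ) : Aˣ where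
  val := (ρ (w : A)).unop
  inv := (ρ (↑w⁻¹ : A)).unop
  val_inv := by rw [← unop_map_mul, Units.inv_mul, map_one, MulOpposite.unop_one]
  inv_val := by rw [← unop_map_mul, Units.mul_inv, map_one, MulOpposite.unop_one]

theorem val_invoUnit (ρ : RingInvo A) (w : Aˣ) : (invoUnit ρ w : A) = (ρ (w : A)).unop := rfl

theorem val_inv_invoUnit (ρ : RingInvo A) (w : Aˣ) :
    (↑(invoUnit ρ w)⁻¹ : A) = (ρ (↑w⁻¹ : A)).unop := rfl

theorem invoUnit_mul (ρ : RingInvo A) (v w : Aˣ) :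
    invoUnit ρ (v * w) = invoUnit ρ w * invoUnit ρ v :=
  Units.ext (unop_map_mul ρ (v : A) w)

theorem invoUnit_invoUnit (ρ : RingInvo A) (w : Aˣ) : invoUnit ρ (invoUnit ρ w) = w :=
  Units.ext (ρ.involution (w : A))

theorem invoUnit_inv (ρ : RingInvo A) (w : Aˣ) : invoUnit ρ w⁻¹ = (invoUnit ρ w)⁻¹ :=
  Units.ext rfl

/-- Involutions `Ψ_{w₁} ∘ R` and `Ψ_{w₂} ∘ R` are equivalent via inner automorphisms exactly when
`w₁` and `w₂` are congruent up to a central factor. -/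
theorem innerEquiv_iff_exists_central {R ρ₁ ρ₂ : RingInvo A} {w₁ w₂ : Aˣ}
    (h₁ : ∀ a, (ρ₁ a).unop = ↑w₁ * (R a).unop * ↑w₁⁻¹)
    (h₂ : ∀ a, (ρ₂ a).unop = ↑w₂ * (R a).unop * ↑w₂⁻¹) :
    InnerEquiv ρ₁ ρ₂ ↔ ∃ v : Aˣ, ∃ z : A, (∀ a, z * a = a * z) ∧
      ((v * w₁ * invoUnit R v : Aˣ) : A) = z * w₂ := by
  constructor
  · rintro ⟨v, hv⟩
    -- The central factor is z = R(v) w₂⁻¹ v w₁; its centrality is the equivalence evaluated at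
    -- R(a).
    have hc : ∀ a : A, (invoUnit R v * w₂⁻¹ * v * w₁ : Aˣ) * a =
        a * (invoUnit R v * w₂⁻¹ * v * w₁ : Aˣ) := fun a => by
      have h := hv (R a).unop
      rw [h₁, h₂, unop_map_mul, unop_map_mul, R.involution, ← val_inv_invoUnit,
        ← val_invoUnit] at h
      have h' := congrArg (fun b : A => ↑(invoUnit R v * w₂⁻¹ : Aˣ) * b * ↑(v * w₁ : Aˣ)) h
      simp only [Units.val_mul, mul_assoc, Units.inv_mul, Units.inv_mul_cancel_left, mul_one,
        Units.mul_inv_cancel_left] at h' ⊢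
      exact h'
    refine ⟨v, _, hc, ?_⟩
    -- Centrality against w₂ R(v)⁻¹ gives z w₂ R(v)⁻¹ = v w₁.
    have hz := congrArg (fun b : A => b * ↑(invoUnit R v)) (hc ↑(w₂ * (invoUnit R v)⁻¹ : Aˣ))
    simp only [Units.val_mul, mul_assoc, Units.inv_mul, Units.inv_mul_cancel_left, mul_one,
      Units.mul_inv_cancel_left] at hz ⊢
    exact hz.symm
  · rintro ⟨v, z, hz, h⟩
    refine ⟨v, fun a => ?_⟩
    rw [h₁, h₂, unop_map_mul, unop_map_mul, ← val_inv_invoUnit, ← val_invoUnit]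
    have e : (v : A) * w₁ = z * w₂ * ↑(invoUnit R v)⁻¹ := by
      rw [← h]
      simp [mul_assoc]
    set g := (R a).unop
    have hk : (invoUnit R v : A) * ↑w₂⁻¹ * (v * w₁) = z := by
      rw [e, mul_assoc z, hz]
      simp [mul_assoc]
    have e1 : (v : A) * w₁ * g = w₂ * (↑(invoUnit R v)⁻¹ * g * (invoUnit R v)) * ↑w₂⁻¹ *
        (v * w₁) := by
      calc (v : A) * w₁ * g = z * (w₂ * ↑(invoUnit R v)⁻¹ * g) := by rw [e]; simp only [mul_assoc]
        _ = w₂ * ↑(invoUnit R v)⁻¹ * g * ((invoUnit R v : A) * ↑w₂⁻¹ * (v * w₁)) := by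
          rw [hz, hk]
        _ = _ := by simp only [mul_assoc]
    have e2 := congrArg (fun b : A => b * ↑(v * w₁)⁻¹) e1
    simpa [mul_assoc] using e2

end InvolutionUnits

/-- A well-order selects one point of each two-element orbit, namely the smaller of x and λ(x). -/
theorem exists_halving {X : Type u} {lam : X → X} (h : ∀ x, lam (lam x) = x) :
    ∃ P : X → Prop, ∀ x, lam x ≠ x → (P (lam x) ↔ ¬ P x) := by
  refine ⟨fun x => WellOrderingRel x (lam x), fun x hx => ?_⟩
  dsimp only
  rw [h]
  refine ⟨fun h1 h2 => asymm_of WellOrderingRel h1 h2, fun h1 => ?_⟩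
  rcases trichotomous_of WellOrderingRel x (lam x) with h2 | h2 | h2
  · exact absurd h2 h1
  · exact absurd h2.symm hx
  · exact h2

/-! ### Normal forms ρ_ε and their equivalence -/

section Classification

variable {X : Type u} {K : Type v} [PartialOrder X] [Field K]
variable {lam : X → X} (hlam : IsPosetInvolution lam) {s : RingInvo K}

/-- The equation is solved orbit by orbit. On a two-element orbit take e = d'/d at the selected
point and 1 at the other; the equation at the other point is then the image under * of the first, by
the symmetry of d and d'. -/
theorem exists_diag_congruence {d d' : X → K}
    (hlam : IsPosetInvolution lam) (hd : ∀ x, d x ≠ 0) (hd' : ∀ x, d' x ≠ 0)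
    (hs : ∀ x, (s (d (lam x))).unop = d x) (hs' : ∀ x, (s (d' (lam x))).unop = d' x)
    (h : ∀ x, lam x = x → ∃ a, a ≠ 0 ∧ a * d x * (s a).unop = d' x) :
    ∃ e : X → K, (∀ x, e x ≠ 0) ∧ ∀ x, e x * d x * (s (e (lam x))).unop = d' x := by
  classical
  obtain ⟨P, hP⟩ := exists_halving hlam.invol
  have h' : ∀ x, ∃ a, lam x = x → a ≠ 0 ∧ a * d x * (s a).unop = d' x := fun x => by
    by_cases hx : lam x = x
    · obtain ⟨a, ha⟩ := h x hx
      exact ⟨a, fun _ => ha⟩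
    · exact ⟨1, fun hx' => absurd hx' hx⟩
  choose a ha using h'
  refine ⟨fun x => if lam x = x then a x else if P x then d' x * (d x)⁻¹ else 1,
    fun x => ?_, fun x => ?_⟩
  · dsimp only
    split_ifs with h1 h2
    · exact (ha x h1).1
    · exact mul_ne_zero (hd' x) (inv_ne_zero (hd x))
    · exact one_ne_zero
  · dsimp only
    by_cases h1 : lam x = x
    · simp only [h1, if_true]
      exact (ha x h1).2
    · have h2 : lam (lam x) ≠ lam x := by
        rw [hlam.invol]
        exact Ne.symm h1
      rw [if_neg h1, if_neg h2]
      by_cases h3 : P x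
      · rw [if_pos h3, if_neg (fun h4 => (hP x h1).1 h4 h3), map_one, MulOpposite.unop_one,
          mul_one, inv_mul_cancel_right₀ (hd x)]
      · have hinv : (s (d (lam x))⁻¹).unop = (d x)⁻¹ := by
          have : s (d (lam x))⁻¹ = (s (d (lam x)))⁻¹ := map_inv₀ (s : K ≃+* Kᵐᵒᵖ) _
          rw [this, MulOpposite.unop_inv, hs]
        rw [if_neg h3, if_pos ((hP x h1).2 h3), unop_map_mul, hinv, hs', one_mul,
          mul_inv_cancel_left₀ (hd x)]

theorem rhoStar_diag (d : X → K) :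
    (rhoStar hlam s (diag d)).unop = diag fun x => (s (d (lam x))).unop := by
  ext x y
  rw [rhoStar_apply, diag_apply, diag_apply]
  by_cases h : x = y
  · rw [if_pos h, if_pos (by rw [h]), h]
  · rw [if_neg h, if_neg fun e => h (by rw [← hlam.invol x, ← e, hlam.invol]), map_zero,
      MulOpposite.unop_zero]

theorem rhoStar_idem (x : X) : (rhoStar hlam s (idem K x)).unop = idem K (lam x) := by
  classical
  rw [idem, rhoStar_diag, idem]
  congr 1
  ext z
  by_cases h : z = lam x
  · rw [if_pos h, if_pos (by rw [h, hlam.invol]), map_one, MulOpposite.unop_one]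
  · rw [if_neg h, if_neg fun e => h (by rw [← e, hlam.invol]), map_zero, MulOpposite.unop_zero]

theorem rhoStar_algebraMap (a : K) :
    (rhoStar hlam s (algebraMap K (FI X K) a)).unop = algebraMap K (FI X K) (s a).unop := by
  rw [algebraMap_eq_diag, rhoStar_diag, algebraMap_eq_diag]

theorem rhoEps_apply (ε : FixedSet lam → (fixedField s)ˣ) (f : FI X K) :
    (rhoEps hlam ε f).unop = ↑(uEps ε) * (rhoStar hlam s f).unop * ↑(uEps ε)⁻¹ := rfl

theorem val_uEps (ε : FixedSet lam → (fixedField s)ˣ) : (uEps ε : FI X K) = diag (epsDiag ε) :=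
  rfl

omit [PartialOrder X] in
theorem epsDiag_of_fixed (ε : FixedSet lam → (fixedField s)ˣ) {x : X} (h : lam x = x) :
    epsDiag ε x = ((ε ⟨x, h⟩ : fixedField s) : K) := dif_pos h

theorem star_epsDiag (hlam : IsPosetInvolution lam) (ε : FixedSet lam → (fixedField s)ˣ) (x : X) :
    (s (epsDiag ε (lam x))).unop = epsDiag ε x := by
  have h := congrArg (fun f : FI X K => f x x) (uEps_symmetric hlam ε)
  simp only [rhoStar_apply] at h
  simpa [val_uEps, diag_apply] using h

theorem rhoEps_induces (ε : FixedSet lam → (fixedField s)ˣ) :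
    Induces (rhoEps hlam ε) lam s := by
  refine ⟨fun x => ⟨uEps ε, ?_⟩, fun a => ?_⟩
  · rw [rhoEps_apply, rhoStar_idem]
  · rw [rhoEps_apply, rhoStar_algebraMap, ← Algebra.commutes, mul_assoc, Units.mul_inv, mul_one]

/-- The composition of `ρ` with `ρ_lam^*` is a `K`-linear automorphism. -/
noncomputable def compRhoStar {ρ : RingInvo (FI X K)} (hρ : Induces ρ lam s) :
    FI X K ≃ₐ[K] FI X K where
  toFun f := (ρ (rhoStar hlam s f).unop).unop
  invFun f := (rhoStar hlam s (ρ f).unop).unop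
  left_inv f := by dsimp only; rw [RingInvo.involution, RingInvo.involution]
  right_inv f := by dsimp only; rw [RingInvo.involution, RingInvo.involution]
  map_mul' f g := by rw [unop_map_mul, unop_map_mul]
  map_add' f g := by simp
  commutes' c := by rw [rhoStar_algebraMap, hρ.field, RingInvo.involution]

theorem compRhoStar_apply {ρ : RingInvo (FI X K)} (hρ : Induces ρ lam s) (f : FI X K) :
    compRhoStar hlam hρ f = (ρ (rhoStar hlam s f).unop).unop := rfl

/-- The unit of a nonzero scalar. -/
noncomputable def scalarUnit (X : Type u) [PartialOrder X] (k : K) (hk : k ≠ 0) : (FI X K)ˣ :=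
  diagUnit (fun _ => k) fun _ => hk

theorem val_scalarUnit (k : K) (hk : k ≠ 0) :
    (scalarUnit X k hk : FI X K) = algebraMap K (FI X K) k := (algebraMap_eq_diag k).symm

/-- Here ρ ∘ R is inner, say Ψ_w, and ρ² = id makes w R(w)⁻¹ a scalar c. At a fixed point x of λ the
entry a = w(x,x) satisfies a = c a*, so a⁻¹w is symmetric and induces the same conjugation. -/
theorem exists_symmetric_unit (hX : ConnectedPoset X) (hM : MultAutInner X K)
    (hfix : ∃ x, lam x = x) {ρ : RingInvo (FI X K)} (hρ : Induces ρ lam s) :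
    ∃ w : (FI X K)ˣ, invoUnit (rhoStar hlam s) w = w ∧
      ∀ f, (ρ f).unop = ↑w * (rhoStar hlam s f).unop * ↑w⁻¹ := by
  obtain ⟨x, hx⟩ := hfix
  have : Nonempty X := ⟨x⟩
  set R := rhoStar hlam s with hR
  obtain ⟨w, hw⟩ := exists_eq_conj (Φ := compRhoStar hlam hρ) hM fun x => by
    obtain ⟨w, hw⟩ := hρ.poset (lam x)
    rw [hlam.invol] at hw
    exact ⟨w, by rw [compRhoStar_apply, rhoStar_idem, hw]⟩
  have hρw : ∀ f, (ρ f).unop = ↑w * (R f).unop * ↑w⁻¹ := fun f => by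
    rw [← hw, compRhoStar_apply, RingInvo.involution]
  obtain ⟨c, hc⟩ := eq_algebraMap_of_commute hX ((w * (invoUnit R w)⁻¹ : (FI X K)ˣ) : FI X K)
    fun g => by
      have h := ρ.involution g
      rw [hρw, hρw, unop_map_mul, unop_map_mul, R.involution, ← val_inv_invoUnit,
        ← val_invoUnit] at h
      have h' := congrArg (fun b : FI X K => b * (w * (invoUnit R w)⁻¹ : (FI X K)ˣ)) h
      simp only [Units.val_mul, mul_assoc, Units.inv_mul_cancel_left, Units.mul_inv,
        mul_one] at h' ⊢
      exact h'
  have hwc : (w : FI X K) = c • (R (w : FI X K)).unop := by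
    rw [Algebra.smul_def, ← hc, Units.val_mul, mul_assoc, ← val_invoUnit, Units.inv_mul, mul_one]
  set a := (w : FI X K) x x with ha
  have ha0 : a ≠ 0 := unit_apply_self_ne_zero w x
  have hac : a = c * (s a).unop := by
    have h := congrArg (fun f : FI X K => f x x) hwc
    simp only [FI.smul_apply, hR, rhoStar_apply, hx] at h
    exact h
  have hsinv : (s a⁻¹).unop = ((s a).unop)⁻¹ := by
    have : s a⁻¹ = (s a)⁻¹ := map_inv₀ (s : K ≃+* Kᵐᵒᵖ) _
    rw [this, MulOpposite.unop_inv]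
  refine ⟨scalarUnit X a⁻¹ (inv_ne_zero ha0) * w, Units.ext ?_, fun f => ?_⟩
  · rw [val_invoUnit, Units.val_mul, val_scalarUnit, unop_map_mul, hR, rhoStar_algebraMap, ← hR,
      ← Algebra.commutes, hsinv]
    conv_rhs => rw [hwc, Algebra.smul_def, ← mul_assoc, ← map_mul]
    congr 2
    conv_rhs => rw [hac]
    have hc0 : c ≠ 0 := fun h => ha0 (by rw [hac, h, zero_mul])
    field_simp
  · have hcen : ∀ g : FI X K, (scalarUnit X a⁻¹ (inv_ne_zero ha0) : FI X K) * g =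
        g * (scalarUnit X a⁻¹ (inv_ne_zero ha0) : FI X K) := fun g => by
      rw [val_scalarUnit, Algebra.commutes]
    rw [hρw, mul_inv_rev, Units.val_mul, Units.val_mul, hcen]
    simp only [mul_assoc]
    rw [← mul_assoc (scalarUnit X a⁻¹ (inv_ne_zero ha0) : FI X K), hcen]
    simp only [mul_assoc]
    rw [← mul_assoc (scalarUnit X a⁻¹ (inv_ne_zero ha0) : FI X K), hcen]
    simp [mul_assoc]

/-- After a diagonal congruence, w' has the diagonal of u = u_ε, so w'u⁻¹ has unit diagonal and is
fixed by ρ_ε. A ρ_ε-fixed square root q satisfies R(q) = u⁻¹qu, whence q⁻¹ w' R(q)⁻¹ = u. -/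
theorem exists_congruence_uEps (h2 : (2 : K) ≠ 0) (w : (FI X K)ˣ)
    (hw : invoUnit (rhoStar hlam s) w = w) :
    ∃ (ε : FixedSet lam → (fixedField s)ˣ) (v : (FI X K)ˣ),
      v * w * invoUnit (rhoStar hlam s) v = uEps ε := by
  have hsym : ∀ x, (s ((w : FI X K) (lam x) (lam x))).unop = (w : FI X K) x x := fun x => by
    rw [← rhoStar_apply hlam, ← val_invoUnit, hw]
  have hne := unit_apply_self_ne_zero w
  have hmem : ∀ x : FixedSet lam, (w : FI X K) x.1 x.1 ∈ fixedField s := fun x => by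
    have h := hsym x.1
    rw [x.2] at h
    exact h
  -- The entries of w at fixed points are kept as ε, so a = 1 serves there and only the two-element
  -- orbits are changed.
  set ε : FixedSet lam → (fixedField s)ˣ := fun x =>
    Units.mk0 ⟨(w : FI X K) x.1 x.1, hmem x⟩ fun h => hne x.1 (congrArg Subtype.val h) with hε
  obtain ⟨e, he0, he⟩ := exists_diag_congruence hlam hne (epsDiag_ne_zero ε) hsym
    (star_epsDiag hlam ε) fun x hx => ⟨1, one_ne_zero, by
      rw [epsDiag_of_fixed ε hx, hε, map_one, MulOpposite.unop_one, one_mul, mul_one]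
      rfl⟩
  set R := rhoStar hlam s with hR
  set v := diagUnit e he0 with hv
  set w' := v * w * invoUnit R v with hw'
  have hw's : invoUnit R w' = w' := by
    rw [hw', invoUnit_mul, invoUnit_mul, hw, invoUnit_invoUnit, mul_assoc]
  have hvd : (v : FI X K) = diag e := rfl
  have hu : invoUnit R (uEps ε) = uEps ε := Units.ext (uEps_symmetric hlam ε)
  have hw'd : ∀ x, (w' : FI X K) x x = epsDiag ε x := fun x => by
    rw [hw', Units.val_mul, Units.val_mul, val_invoUnit, hvd, hR, rhoStar_diag, mul_diag_apply,
      diag_mul_apply, he]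
  have huinv : ((uEps ε)⁻¹ : (FI X K)ˣ) = diag fun x => (epsDiag ε x)⁻¹ := rfl
  obtain ⟨q, hq, hqτ⟩ := exists_symmetric_sqrt h2
    (r := ((w' * (uEps ε)⁻¹ : (FI X K)ˣ) : FI X K)) fun x => by
      rw [Units.val_mul, huinv, mul_diag_apply, hw'd, mul_inv_cancel₀ (epsDiag_ne_zero ε x)]
  -- Locality holds because the (x, y) entry of ρ_ε(f) depends only on f(λ(y), λ(x)).
  have hqs := hqτ (rhoEps hlam ε) (by
      rw [rhoEps_apply, ← hR, ← val_invoUnit, invoUnit_mul, invoUnit_inv, hu, hw's]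
      simp) fun x y => ⟨lam y, lam x, fun f g hfg => by
      rw [rhoEps_apply, rhoEps_apply, val_uEps, huinv, mul_diag_apply, diag_mul_apply,
        mul_diag_apply, diag_mul_apply, rhoStar_apply, rhoStar_apply,
        hfg _ _ le_rfl le_rfl]⟩
  have hqu : IsUnit q := by
    rw [← isUnit_pow_iff two_ne_zero, sq, hq]
    exact Units.isUnit _
  obtain ⟨q, rfl⟩ := hqu
  have hq' : q * q = w' * (uEps ε)⁻¹ := Units.ext hq
  have hqs' : uEps ε * invoUnit R q * (uEps ε)⁻¹ = q := Units.ext hqs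
  refine ⟨ε, q⁻¹ * v, ?_⟩
  have h3 : invoUnit R q = (uEps ε)⁻¹ * q * uEps ε := by
    conv_rhs => rw [← hqs']
    group
  have h4 : w' = q * q * uEps ε := by rw [hq', inv_mul_cancel_right]
  calc q⁻¹ * v * w * invoUnit R (q⁻¹ * v) = q⁻¹ * w' * (invoUnit R q)⁻¹ := by
        rw [invoUnit_mul, invoUnit_inv, hw']
        group
    _ = uEps ε := by
        rw [h3, h4]
        group

theorem exists_innerEquiv_rhoEps (h2 : (2 : K) ≠ 0) (hX : ConnectedPoset X)
    (hM : MultAutInner X K) (hfix : ∃ x, lam x = x) {ρ : RingInvo (FI X K)}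
    (hρ : Induces ρ lam s) :
    ∃ ε : FixedSet lam → (fixedField s)ˣ, InnerEquiv ρ (rhoEps hlam ε) := by
  obtain ⟨w, hw, hρw⟩ := exists_symmetric_unit hlam hX hM hfix hρ
  obtain ⟨ε, v, hv⟩ := exists_congruence_uEps hlam h2 w hw
  refine ⟨ε, (innerEquiv_iff_exists_central hρw (rhoEps_apply hlam ε)).2
    ⟨v, 1, fun a => by rw [one_mul, mul_one], by rw [hv, one_mul]⟩⟩

omit [PartialOrder X] in
-- This puts equality of classes in the form that a congruence up to a scalar takes on the diagonal
-- at fixed points.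
theorem thetaClass_eq_iff {ε ε' : FixedSet lam → (fixedField s)ˣ} :
    thetaClass ε = thetaClass ε' ↔ ∃ k : (fixedField s)ˣ, ∀ x, ∃ a : K, a ≠ 0 ∧
      a * ((ε x : fixedField s) : K) * (s a).unop = (k : fixedField s) * (ε' x : fixedField s) := by
  have key : ∀ (k : (fixedField s)ˣ) x,
      (QuotientGroup.mk k * QuotientGroup.mk (ε' x) : NormQuotient s) = QuotientGroup.mk (ε x) ↔
        ∃ a : K, a ≠ 0 ∧ a * ((ε x : fixedField s) : K) * (s a).unop =
          (k : fixedField s) * (ε' x : fixedField s) := by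
    intro k x
    rw [← QuotientGroup.mk_mul, eq_comm, QuotientGroup.eq]
    refine exists_congr fun a => and_congr_right fun _ => ?_
    have h0 : ((ε x : fixedField s) : K) ≠ 0 := by simp
    rw [Units.val_mul, Units.val_mul, Subfield.coe_mul, Subfield.coe_mul,
      Units.val_inv_eq_inv_val, Subfield.coe_inv, inv_mul_eq_iff_eq_mul₀ h0, eq_comm,
      ← mul_assoc, mul_comm a]
  unfold thetaClass
  rw [Quotient.eq, MulAction.orbitRel_apply, MulAction.mem_orbit_iff]
  constructor
  · rintro ⟨g, hg⟩
    obtain ⟨k, rfl⟩ := QuotientGroup.mk_surjective g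
    exact ⟨k, fun x => (key k x).1 (congrFun hg x)⟩
  · rintro ⟨k, hk⟩
    exact ⟨QuotientGroup.mk k, funext fun x => (key k x).2 (hk x)⟩

/-- A congruence v u_ε R(v) = k u_ε' read at the diagonal entries over X₃ is equality of classes.
Conversely, norms at the fixed points suffice, since the two-element orbits impose no condition. -/
theorem innerEquiv_rhoEps_iff (hX : ConnectedPoset X) (hfix : ∃ x, lam x = x)
    {ε ε' : FixedSet lam → (fixedField s)ˣ} :
    InnerEquiv (rhoEps hlam ε) (rhoEps hlam ε') ↔ thetaClass ε = thetaClass ε' := by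
  obtain ⟨x₀, hx₀⟩ := hfix
  have : Nonempty X := ⟨x₀⟩
  rw [innerEquiv_iff_exists_central (rhoEps_apply hlam ε) (rhoEps_apply hlam ε'),
    thetaClass_eq_iff]
  constructor
  · rintro ⟨v, z, hz, h⟩
    obtain ⟨k, rfl⟩ := eq_algebraMap_of_commute hX z hz
    have hx : ∀ x : FixedSet lam, (v : FI X K) x.1 x.1 * ((ε x : fixedField s) : K) *
        (s ((v : FI X K) x.1 x.1)).unop = k * ((ε' x : fixedField s) : K) := fun x => by
      have h' := congrArg (fun f : FI X K => f x.1 x.1) h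
      simp only [Units.val_mul, val_uEps, algebraMap_eq_diag, mul_apply_self,
        val_invoUnit, rhoStar_apply, x.2] at h'
      simpa only [diag_apply, if_true, epsDiag_of_fixed _ x.2] using h'
    have hv := unit_apply_self_ne_zero v
    have hε : ∀ (η : FixedSet lam → (fixedField s)ˣ) x, ((η x : fixedField s) : K) ≠ 0 :=
      fun η x => by simp
    have hs0 : ∀ a : K, a ≠ 0 → (s a).unop ≠ 0 := fun a ha h => ha (by
      rw [← s.involution a, h, map_zero, MulOpposite.unop_zero])
    have hk0 : k ≠ 0 := fun hk => by
      have := hx ⟨x₀, hx₀⟩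
      rw [hk, zero_mul] at this
      exact mul_ne_zero (mul_ne_zero (hv _) (hε ε _)) (hs0 _ (hv _)) this
    -- Applying * to the relation at one fixed point leaves its left side and ε' unchanged, so k* =
    -- k.
    have hks : k ∈ fixedField s := by
      have h1 := hx ⟨x₀, hx₀⟩
      have h2 := congrArg (fun a => (s a).unop) h1
      simp only [unop_map_mul, s.involution] at h2
      have e1 : (s ((ε ⟨x₀, hx₀⟩ : fixedField s) : K)).unop = (ε ⟨x₀, hx₀⟩ : fixedField s) :=
        (ε ⟨x₀, hx₀⟩ : fixedField s).2
      have e2 : (s ((ε' ⟨x₀, hx₀⟩ : fixedField s) : K)).unop = (ε' ⟨x₀, hx₀⟩ : fixedField s) :=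
        (ε' ⟨x₀, hx₀⟩ : fixedField s).2
      rw [e1, e2, ← mul_assoc, h1, mul_comm] at h2
      exact (mul_left_cancel₀ (hε ε' _) h2).symm
    exact ⟨Units.mk0 ⟨k, hks⟩ fun e => hk0 (congrArg Subtype.val e),
      fun x => ⟨_, hv x.1, hx x⟩⟩
  · rintro ⟨k, hk⟩
    have hk0 : ((k : fixedField s) : K) ≠ 0 := by simp
    have hks : (s ((k : fixedField s) : K)).unop = (k : fixedField s) := (k : fixedField s).2
    obtain ⟨e, he0, he⟩ := exists_diag_congruence hlam (epsDiag_ne_zero ε)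
      (d' := fun x => ((k : fixedField s) : K) * epsDiag ε' x)
      (fun x => mul_ne_zero hk0 (epsDiag_ne_zero ε' x)) (star_epsDiag hlam ε)
      (fun x => by rw [unop_map_mul, star_epsDiag hlam, hks, mul_comm])
      fun x hx => by
        obtain ⟨a, ha⟩ := hk ⟨x, hx⟩
        exact ⟨a, by rwa [epsDiag_of_fixed ε hx, epsDiag_of_fixed ε' hx]⟩
    refine ⟨diagUnit e he0, algebraMap K (FI X K) (k : fixedField s), Algebra.commutes _, ?_⟩
    have hvd : (diagUnit e he0 : FI X K) = diag e := rfl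
    rw [Units.val_mul, Units.val_mul, val_invoUnit, hvd, val_uEps, val_uEps, rhoStar_diag,
      algebraMap_eq_diag, diag_mul_diag, diag_mul_diag, diag_mul_diag]
    exact congrArg diag (funext he)

/-! ### Counting the classes -/

omit [PartialOrder X] in
theorem thetaClass_surjective (c : ThetaClass lam s) :
    ∃ ε : FixedSet lam → (fixedField s)ˣ, thetaClass ε = c := by
  induction c using Quotient.inductionOn with
  | h θ =>
    refine ⟨fun x => (θ x).out, ?_⟩
    unfold thetaClass
    simp only [QuotientGroup.out_eq']

omit [PartialOrder X] in
/-- Every class of maps `X₃ → K₀ˣ/K₁` has a unique representative with value `1` at `x₀`. -/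
theorem mk_thetaClass (x₀ : FixedSet lam) :
    #(ThetaClass lam s) =
      Cardinal.lift.{u} #(NormQuotient s) ^
        Cardinal.lift.{v} #{x : FixedSet lam // x ≠ x₀} := by
  classical
  rw [← Cardinal.mk_arrow]
  refine (Cardinal.mk_congr (Equiv.ofBijective
    (fun η : {x : FixedSet lam // x ≠ x₀} → NormQuotient s =>
      (Quotient.mk _ fun x => if h : x = x₀ then 1 else η ⟨x, h⟩ : ThetaClass lam s))
    ⟨fun η η' h => ?_, fun c => ?_⟩)).symm
  · obtain ⟨g, hg⟩ := MulAction.mem_orbit_iff.1 (MulAction.orbitRel_apply.1 (Quotient.exact h))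
    -- Both representatives are 1 at x₀, which forces the translating element to be 1.
    have hg1 : g = 1 := by
      have h1 := congrFun hg x₀
      simp only [Pi.smul_apply, dif_pos] at h1
      exact (mul_one g).symm.trans h1
    subst hg1
    ext x
    have := congrFun hg x.1
    rw [one_smul] at this
    simpa [x.2] using this.symm
  · induction c using Quotient.inductionOn with
    | h θ =>
      -- Translation by θ(x₀)⁻¹ normalises θ at x₀.
      refine ⟨fun x => (θ x₀)⁻¹ * θ x.1, Quotient.sound ?_⟩
      refine MulAction.orbitRel_apply.2 (MulAction.mem_orbit_iff.2 ⟨(θ x₀)⁻¹, funext fun x => ?_⟩)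
      by_cases h : x = x₀
      · simp [h]
      · simp [h]

/-- Sending the class of θ_ε to the class of ρ_ε is injective by `innerEquiv_rhoEps_iff` and
surjective by `exists_innerEquiv_rhoEps`. -/
theorem mk_quotient_innerSetoid (hlam : IsPosetInvolution lam) (h2 : (2 : K) ≠ 0) (hX : ConnectedPoset X)
    (hM : MultAutInner X K) (hfix : ∃ x, lam x = x) :
    #(Quotient (innerSetoid (K := K) lam s)) = #(ThetaClass lam s) := by
  choose ε hε using thetaClass_surjective (X := X) (lam := lam) (s := s)
  refine (Cardinal.mk_congr (Equiv.ofBijective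
    (fun c => (Quotient.mk _ ⟨rhoEps hlam (ε c), rhoEps_induces hlam (ε c)⟩ :
      Quotient (innerSetoid (K := K) lam s))) ⟨fun c c' h => ?_, fun q => ?_⟩)).symm
  · have h' : InnerEquiv (rhoEps hlam (ε c)) (rhoEps hlam (ε c')) := Quotient.exact h
    rw [innerEquiv_rhoEps_iff hlam hX hfix, hε, hε] at h'
    exact h'
  · induction q using Quotient.inductionOn with
    | h ρ =>
      obtain ⟨η, hη⟩ := exists_innerEquiv_rhoEps hlam h2 hX hM hfix ρ.2
      refine ⟨thetaClass η, Quotient.sound ?_⟩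
      exact innerEquiv_trans ((innerEquiv_rhoEps_iff hlam hX hfix).2 (hε _)) (innerEquiv_symm hη)

end Classification

end FinInc

theorem theorem4p11 {X : Type u} {K : Type v} [PartialOrder X] [Field K]
    (hK : ringChar K ≠ 2) (hX : FinInc.ConnectedPoset X) (hM : FinInc.MultAutInner X K)
    (s : RingInvo K) (hs : FinInc.IsSecondKind s)
    (lam : X → X) (hlam : FinInc.IsPosetInvolution lam) (hfix : ∃ x, lam x = x) :
    (∀ ρ : RingInvo (FinInc.FI X K), FinInc.Induces ρ lam s →
      ∃! c : FinInc.ThetaClass lam s, FinInc.InducesClass hlam s ρ c) ∧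
    (∀ ρ₁ ρ₂ : RingInvo (FinInc.FI X K),
      FinInc.Induces ρ₁ lam s → FinInc.Induces ρ₂ lam s →
      (FinInc.InnerEquiv ρ₁ ρ₂ ↔ ∃ c : FinInc.ThetaClass lam s,
        FinInc.InducesClass hlam s ρ₁ c ∧ FinInc.InducesClass hlam s ρ₂ c)) ∧
    (∀ x₀ : FinInc.FixedSet lam,
      #(Quotient (FinInc.innerSetoid (K := K) lam s)) =
        Cardinal.lift.{u} #(FinInc.NormQuotient s) ^
          Cardinal.lift.{v} #{x : FinInc.FixedSet lam // x ≠ x₀}) := by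
  have h2 : (2 : K) ≠ 0 := Ring.two_ne_zero hK
  refine ⟨fun ρ hρ => ?_, fun ρ₁ ρ₂ h₁ h₂ => ⟨fun h => ?_, ?_⟩, fun x₀ => ?_⟩
  · obtain ⟨ε, hε⟩ := FinInc.exists_innerEquiv_rhoEps hlam h2 hX hM hfix hρ
    refine ⟨FinInc.thetaClass ε, ⟨ε, hε, rfl⟩, ?_⟩
    rintro _ ⟨ε', hε', rfl⟩
    exact (FinInc.innerEquiv_rhoEps_iff hlam hX hfix).1
      (FinInc.innerEquiv_trans (FinInc.innerEquiv_symm hε') hε)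
  · obtain ⟨ε, hε⟩ := FinInc.exists_innerEquiv_rhoEps hlam h2 hX hM hfix h₂
    exact ⟨_, ⟨ε, FinInc.innerEquiv_trans h hε, rfl⟩, ⟨ε, hε, rfl⟩⟩
  · rintro ⟨c, ⟨ε, hε, rfl⟩, ⟨ε', hε', he⟩⟩
    exact FinInc.innerEquiv_trans hε (FinInc.innerEquiv_trans
      ((FinInc.innerEquiv_rhoEps_iff hlam hX hfix).2 he.symm) (FinInc.innerEquiv_symm hε'))
  · rw [FinInc.mk_quotient_innerSetoid hlam h2 hX hM hfix, FinInc.mk_thetaClass x₀]
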